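/- Let $p,q\in L_2(0,\pi)$ be real valued, $0\le a\le\pi$, $\alpha>0$, $\alpha\neq1$, $h_1\in\mathbb R$, $h_2>0$. Put $\rho(x)=1$ and $\mu(x)=x$ for $0\le x\le a$, and $\rho(x)=\alpha$ and $\mu(x)=\alpha x-\alpha a+a$ for $a<x\le\pi$. Consider the boundary value problem $$By'+\Omega(x)y=\lambda\rho(x)y,\quad 0<x<\pi,\qquad y_1(0)=0,\qquad (\lambda+h_1)y_1(\pi)+h_2y_2(\pi)=0,$$ $$B=\begin{pmatrix}0&1\\-1&0\end{pmatrix},\qquad \Omega=\begin{pmatrix}p&q\\q&-p\end{pmatrix},\qquad y=\begin{pmatrix}y_1\\y_2\end{pmatrix},$$ where solutions are absolutely continuous $\mathbb C^2$-valued functions on $[0,\pi]$ that satisfy the system almost everywhere and $\lambda\in\mathbb C$. For $\lambda\in\mathbb C$ there is exactly one solution $\varphi(x,\lambda)=(\varphi_1,\varphi_2)^T$ of the system on $[0,\pi]$ with $\varphi(0,\lambda)=(0,-1)^T$. Let $\Delta(\lambda)=(\lambda+h_1)\varphi_1(\pi,\lambda)+h_2\varphi_2(\pi,\lambda)$ be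 the characteristic function, and let the normalizing number belonging to an eigenvalue $\lambda_n$ be $$\alpha_n=\int_0^\pi\left(|\varphi_1(x,\lambda_n)|^2+|\varphi_2(x,\lambda_n)|^2\right)\rho(x)\,dx+\frac1{h_2}|\varphi_1(\pi,\lambda_n)|^2 .$$ Let $I=\mathbb Z\cup\{*\}$ be the set of integers with one further index $*$, and let $\lambda^0_n=\frac{n\pi}{\mu(\pi)}$ for $n\in\mathbb Z$ and $\lambda^0_*=0$. The numbers $\lambda_n^0$, $n\in I$, are the zeros, listed with multiplicity, of the function $\lambda\sin(\lambda\mu(\pi))$ (which has a double zero at $0$). Then the eigenvalues of the boundary value problem are the zeros of $\Delta$, and they can be listed as $\lambda_n$, $n\in I$, each as often as its order as a zero of $\Delta$, in such a way that the following holds. i) $\lambda_n=\lambda_n^0+\epsilon_n$ with $\{\epsilon_n\}_{n\in I}\in l_2$, and for $n\in\mathbb Z$ with $|n|$ large the eigenvalue $\lambda_n$ is simple, i.e. a zero of $\Delta$ of order one. ii) For each $n\in I$ the function $\varphi(x,\lambda_n)$ is an eigenfunction, every eigenfunction belonging to $\lambda_n$ is a constant multiple of it, and $$\varphi(x,\lambda_n)=\begin{pmatrix}\sin\lambda_n^0\mu(x)\\-\cos\lambda_n^0\mu(x)\end{pmatrix}+\begin{pmatrix}\zeta_n^{(1)}(x)\\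 \zeta_n^{(2)}(x)\end{pmatrix},\qquad \sum_{n\in I}\left\{|\zeta_n^{(1)}(x)|^2+|\zeta_n^{(2)}(x)|^2\right\}\le C\quad\text{for all }x\in[0,\pi],$$ with a number $C>0$ that does not depend on $x$ (recall $\lambda_n^0\mu(x)=\frac{n\pi\mu(x)}{\mu(\pi)}$ for $n\in\mathbb Z$). iii) $\alpha_n=\mu(\pi)+\tau_n$ with $\{\tau_n\}_{n\in I}\in l_2$. -/

import Mathlib

open Real MeasureTheory Set

namespace DiracBVP

/-- The discontinuous weight: `1` on `[0, a]` and `α` on `(a, π]`. -/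
noncomputable def rho (a α x : ℝ) : ℝ := if x ≤ a then 1 else α

/-- `μ(x) = ∫₀ˣ ρ`, i.e. `x` for `x ≤ a` and `α x - α a + a` for `x > a`. -/
noncomputable def mu (a α x : ℝ) : ℝ := if x ≤ a then x else α * x - α * a + a

/-- `y = (y₁, y₂)` is a solution on `[0, π]` of `B y' + Ω(x) y = lam ρ(x) y`, where
`B = (0 1; -1 0)` and `Ω = (p q; q -p)`: it is absolutely continuous on `[0, π]` and satisfies
the system almost everywhere. -/
structure IsSolution (p q : ℝ → ℝ) (a α : ℝ) (lam : ℂ) (y : ℝ → ℂ × ℂ) : Prop where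
  absolutelyContinuous : AbsolutelyContinuousOnInterval y 0 π
  equation : ∀ᵐ x ∂(volume.restrict (Ioo (0 : ℝ) π)), ∃ y' : ℂ × ℂ, HasDerivAt y y' x ∧
    y'.2 + (p x : ℂ) * (y x).1 + (q x : ℂ) * (y x).2 = lam * (rho a α x : ℂ) * (y x).1 ∧
    -y'.1 + (q x : ℂ) * (y x).1 - (p x : ℂ) * (y x).2 = lam * (rho a α x : ℂ) * (y x).2

/-- `y` is an eigenfunction with eigenvalue `lam` of the boundary value problem: a solution that
does not vanish identically on `[0, π]` and satisfies `y₁(0) = 0` and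
`(lam + h₁) y₁(π) + h₂ y₂(π) = 0`. -/
structure IsEigenfunction (p q : ℝ → ℝ) (a α h₁ h₂ : ℝ) (lam : ℂ) (y : ℝ → ℂ × ℂ) : Prop where
  solution : IsSolution p q a α lam y
  left : (y 0).1 = 0
  right : (lam + (h₁ : ℂ)) * (y π).1 + (h₂ : ℂ) * (y π).2 = 0
  nontrivial : ∃ x ∈ Icc (0 : ℝ) π, y x ≠ 0

/-- `lam` is an eigenvalue of the boundary value problem. -/
def IsEigenvalue (p q : ℝ → ℝ) (a α h₁ h₂ : ℝ) (lam : ℂ) : Prop :=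
  ∃ y : ℝ → ℂ × ℂ, IsEigenfunction p q a α h₁ h₂ lam y

/-- `φ(·, lam)`: the solution with `φ(0, lam) = (0, -1)`. It is determined on `[0, π]`, and only
its values there are used. -/
noncomputable def phi (p q : ℝ → ℝ) (a α : ℝ) (lam : ℂ) : ℝ → ℂ × ℂ :=
  Classical.epsilon fun y : ℝ → ℂ × ℂ => IsSolution p q a α lam y ∧ y 0 = (0, -1)

/-- The characteristic function `Δ(lam) = (lam + h₁) φ₁(π, lam) + h₂ φ₂(π, lam)`, i.e. the
Wronskian `φ₂ ψ₁ - φ₁ ψ₂` at `x = π`, where `ψ(π, lam) = (h₂, -lam - h₁)`. -/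
noncomputable def charFun (p q : ℝ → ℝ) (a α h₁ h₂ : ℝ) (lam : ℂ) : ℂ :=
  (lam + (h₁ : ℂ)) * (phi p q a α lam π).1 + (h₂ : ℂ) * (phi p q a α lam π).2

/-- The normalizing number belonging to `lam`. -/
noncomputable def normNumber (p q : ℝ → ℝ) (a α h₂ : ℝ) (lam : ℂ) : ℝ :=
  (∫ x in (0 : ℝ)..π,
      (‖(phi p q a α lam x).1‖ ^ 2 + ‖(phi p q a α lam x).2‖ ^ 2) * rho a α x) +
    1 / h₂ * ‖(phi p q a α lam π).1‖ ^ 2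

/-- The numbers `n π / μ(π)`, `n ∈ ℤ`, together with one more copy of `0` (index `none`): the list
of the zeros, with multiplicity, of `z ↦ z sin (z μ(π))`, which has a double zero at `0`. -/
noncomputable def lamZero (a α : ℝ) : Option ℤ → ℝ
  | none => 0
  | some n => n * π / mu a α π

end DiracBVP

/-!
The weight is integrated away by `μ`: for zero potential the solution is `(sin (l μ), -cos (l μ))`.
The potential is treated as a perturbation of the phase `l μ(x)`.

**Existence and spectrum.** Solved for `y'`, the system is linear with square integrable
coefficients. Existence of `φ` is a contraction argument in an exponentially weighted norm,
uniqueness and continuity in the parameter are Grönwall's inequality. Lagrange's identity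
`(w - z) ∫ ρ (y₁ u₁ + y₂ u₂) = [y₁ u₂ - y₂ u₁]` gives the rest: `Δ` is entire, because Wronskians
of `φ(·, z)` with a fixed fundamental system are differentiable in `z`; its zeros are the
eigenvalues and, by the sign `h₂ > 0`, they are real (`Admissible.conj_eq_of_charFun_eq_zero`) and
simple (`Admissible.analyticOrderAt_charFun_eq_one`). So all multiplicities are one, and the
listing of the zeros is a bijection.

**Prüfer phase.** For real `l` the solution is real and `φ₁ + i φ₂ = -i exp (i l μ + Λ_l)`, where
`Λ_l` is `logRatio`. So `φ = exp (Re Λ) (sin θ, -cos θ)` with the phase `θ = l μ + Im Λ`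
(`Admissible.phi_eq_phase`). Moreover `Λ_l(x) = -∫₀ˣ (q - i p) exp (-2 i θ)`, so that `Λ_l` is
bounded uniformly in `l` and `x`. Again by Lagrange's identity, `θ(π)` is strictly increasing in
`l`; so is `θ(π) + arctan ((l + h₁) / h₂)`, whose values `π / 2 + k π` are taken exactly at the
zeros of `Δ`. The arctangent gains `π` between `-∞` and `∞`; this accounts for the index `*`, and
after renumbering (`turns`) the zeros satisfy
`(λ_i - λ_i⁰) μ(π) = boundaryShift_i - Im Λ(π)`, where the boundary shift is `O(1 / n)`
(`Admissible.exists_numbering`). In particular `λ_i - λ_i⁰` is bounded.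

**Square sums.** For frequencies at bounded distance from `n π / μ(π)`, the integrals
`∫₀ˣ (q - i p) exp (-2 i l μ)` have square sums bounded uniformly in `x`. At the unperturbed
frequencies this is Bessel's inequality on the two intervals where `μ` is affine; the perturbation
is removed by an integration by parts (`Admissible.exists_sum_sq_norm_integral_wave_le`). The
integral equation and Grönwall's inequality with the square integrable kernel `2 |q - i p|` carry
the bound over to `Λ` (`Admissible.exists_sum_sq_norm_logRatio_le`). At `x = π` this bounds the
square sum of `λ_i - λ_i⁰`; with Prüfer's form it bounds the deviations of `φ` from the free
solutions for each `x`; and since `|φ|² = exp (2 Re Λ)` and `sin (λ_i⁰ μ(π)) = 0`, it bounds those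
of the normalizing numbers from `∫ ρ = μ(π)` (`Admissible.exists_sum_bounds`).
-/

/-! ### Absolutely continuous primitives -/

namespace DiracBVP

open Filter Topology

variable {E F : Type*} [NormedAddCommGroup E] [NormedSpace ℝ E] [NormedAddCommGroup F]
  [NormedSpace ℝ F]

/-- Absolute continuity passes to every function whose increments are dominated by those of an
absolutely continuous function. -/
theorem absolutelyContinuousOnInterval_of_dist_le {X Y : Type*} [PseudoMetricSpace X]
    [PseudoMetricSpace Y] {u : ℝ → X} {v : ℝ → Y} {a b K : ℝ}
    (hv : AbsolutelyContinuousOnInterval v a b)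
    (h : ∀ x ∈ uIcc a b, ∀ y ∈ uIcc a b, dist (u x) (u y) ≤ K * dist (v x) (v y)) :
    AbsolutelyContinuousOnInterval u a b := by
  have h0 := Filter.Tendsto.const_mul K hv
  rw [mul_zero] at h0
  refine squeeze_zero' ?_ ?_ h0
  · exact Eventually.of_forall fun _ => Finset.sum_nonneg fun _ _ => dist_nonneg
  · refine eventually_inf_principal.2 (Eventually.of_forall ?_)
    rintro ⟨n, I⟩ hI
    simp only [Finset.mul_sum]
    have hI' := hI.1
    refine Finset.sum_le_sum fun i hi => ?_
    exact h _ (hI' i hi).1 _ (hI' i hi).2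

/-- `u` is an absolutely continuous primitive of the integrable function `g` on the interval with
end points `a` and `b`. -/
structure IsPrimitive (u g : ℝ → E) (a b : ℝ) : Prop where
  absolutelyContinuous : AbsolutelyContinuousOnInterval u a b
  intervalIntegrable : IntervalIntegrable g volume a b
  ae_hasDerivAt : ∀ᵐ x, x ∈ uIcc a b → HasDerivAt u (g x) x

theorem absolutelyContinuousOnInterval_integral {g : ℝ → E} {a b c : ℝ}
    (hg : IntervalIntegrable g volume a b) (hc : c ∈ uIcc a b) :
    AbsolutelyContinuousOnInterval (fun x => ∫ t in c..x, g t) a b := by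
  refine absolutelyContinuousOnInterval_of_dist_le (K := 1)
    (hg.norm.absolutelyContinuousOnInterval_intervalIntegral hc) fun x hx y hy => ?_
  have hI : ∀ z ∈ uIcc a b, IntervalIntegrable g volume c z := fun z hz =>
    hg.mono_set (uIcc_subset_uIcc hc hz)
  rw [dist_eq_norm, dist_eq_norm, one_mul,
    intervalIntegral.integral_interval_sub_left (hI x hx) (hI y hy),
    intervalIntegral.integral_interval_sub_left (hI x hx).norm (hI y hy).norm]
  exact intervalIntegral.norm_integral_le_abs_integral_norm

namespace IsPrimitive

variable {u g : ℝ → E} {v h : ℝ → ℂ} {a b : ℝ}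

theorem continuousOn (hu : IsPrimitive u g a b) : ContinuousOn u (uIcc a b) :=
  hu.absolutelyContinuous.continuousOn

theorem mono (hu : IsPrimitive u g a b) {c d : ℝ} (hcd : uIcc c d ⊆ uIcc a b) :
    IsPrimitive u g c d :=
  ⟨hu.absolutelyContinuous.mono hcd, hu.intervalIntegrable.mono_set hcd,
    hu.ae_hasDerivAt.mono fun _ hx hxc => hx (hcd hxc)⟩

variable [CompleteSpace E] in
theorem of_integral {g : ℝ → E} {a b : ℝ} (hg : IntervalIntegrable g volume a b) (c : E) :
    IsPrimitive (fun x => c + ∫ t in a..x, g t) g a b where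
  absolutelyContinuous := by
    refine absolutelyContinuousOnInterval_of_dist_le (K := 1)
      (absolutelyContinuousOnInterval_integral hg left_mem_uIcc) fun x _ y _ => ?_
    simp
  intervalIntegrable := hg
  ae_hasDerivAt := by
    filter_upwards [hg.ae_hasDerivAt_integral] with x hx hxb
    exact (hx hxb a left_mem_uIcc).const_add c

variable [CompleteSpace E] in
/-- The fundamental theorem of calculus for absolutely continuous functions. -/
theorem eq_add_integral (hu : IsPrimitive u g a b) :
    ∀ x ∈ uIcc a b, u x = u a + ∫ t in a..x, g t := by
  have hp := of_integral hu.intervalIntegrable (0 : E)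
  obtain ⟨C, hC⟩ := AbsolutelyContinuousOnInterval.const_of_ae_hasDerivAt_zero
    (hu.absolutelyContinuous.sub hp.absolutelyContinuous) (by
      filter_upwards [hu.ae_hasDerivAt, hp.ae_hasDerivAt] with x hx hx' hxb
      simpa using (hx hxb).sub (hx' hxb))
  intro x hx
  have h1 := hC x hx
  have h2 := hC a left_mem_uIcc
  simp only [Pi.sub_apply, zero_add, intervalIntegral.integral_same, sub_zero] at h1 h2
  rw [h2, ← h1]
  abel

theorem congr (hu : IsPrimitive u g a b) {g' : ℝ → E} (h : ∀ x, g x = g' x) :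
    IsPrimitive u g' a b := by
  rwa [show g' = g from (funext h).symm]

theorem add {w k : ℝ → E} (hu : IsPrimitive u g a b) (hw : IsPrimitive w k a b) :
    IsPrimitive (fun x => u x + w x) (fun x => g x + k x) a b :=
  ⟨hu.absolutelyContinuous.add hw.absolutelyContinuous,
    hu.intervalIntegrable.add hw.intervalIntegrable, by
      filter_upwards [hu.ae_hasDerivAt, hw.ae_hasDerivAt] with x hx hx' hxb
      exact (hx hxb).add (hx' hxb)⟩

theorem clm_comp (hu : IsPrimitive u g a b) (T : E →L[ℝ] F) :
    IsPrimitive (fun x => T (u x)) (fun x => T (g x)) a b where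
  absolutelyContinuous := by
    refine absolutelyContinuousOnInterval_of_dist_le (K := ‖T‖) hu.absolutelyContinuous
      fun x _ y _ => ?_
    rw [dist_eq_norm, dist_eq_norm, ← map_sub]
    exact T.le_opNorm _
  intervalIntegrable :=
    ⟨T.integrable_comp hu.intervalIntegrable.1, T.integrable_comp hu.intervalIntegrable.2⟩
  ae_hasDerivAt := by
    filter_upwards [hu.ae_hasDerivAt] with x hx hxb
    exact T.hasFDerivAt.comp_hasDerivAt x (hx hxb)

theorem sub {w k : ℝ → E} (hu : IsPrimitive u g a b) (hw : IsPrimitive w k a b) :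
    IsPrimitive (fun x => u x - w x) (fun x => g x - k x) a b := by
  simpa [sub_eq_add_neg] using hu.add (hw.clm_comp (-ContinuousLinearMap.id ℝ E))

theorem const_mul (hv : IsPrimitive v h a b) (c : ℂ) :
    IsPrimitive (fun x => c * v x) (fun x => c * h x) a b :=
  hv.clm_comp (ContinuousLinearMap.mul ℝ ℂ c)

theorem mul {w k : ℝ → ℂ} (hv : IsPrimitive v h a b) (hw : IsPrimitive w k a b) :
    IsPrimitive (fun x => v x * w x) (fun x => h x * w x + v x * k x) a b :=
  ⟨hv.absolutelyContinuous.smul hw.absolutelyContinuous,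
    (hv.intervalIntegrable.mul_continuousOn hw.continuousOn).add
      (hw.intervalIntegrable.continuousOn_mul hv.continuousOn), by
      filter_upwards [hv.ae_hasDerivAt, hw.ae_hasDerivAt] with x hx hx' hxb
      exact (hx hxb).mul (hx' hxb)⟩

theorem cexp (hv : IsPrimitive v h a b) :
    IsPrimitive (fun x => Complex.exp (v x)) (fun x => Complex.exp (v x) * h x) a b := by
  have hc : ContinuousOn (fun x => Complex.exp (v x)) (uIcc a b) := hv.continuousOn.cexp
  obtain ⟨R, hR⟩ := hv.absolutelyContinuous.exists_bound
  have hL : ∃ K : NNReal, LipschitzOnWith K Complex.exp (Metric.closedBall 0 R) :=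
    (Complex.contDiff_exp (n := 1)).contDiffOn.exists_lipschitzOnWith (by decide)
      (convex_closedBall 0 R) (isCompact_closedBall 0 R)
  obtain ⟨K, hK⟩ := hL
  refine ⟨absolutelyContinuousOnInterval_of_dist_le (K := K) hv.absolutelyContinuous
    fun x hx y hy => hK.dist_le_mul _ (by simpa using hR x hx) _ (by simpa using hR y hy),
    hv.intervalIntegrable.continuousOn_mul hc, ?_⟩
  filter_upwards [hv.ae_hasDerivAt] with x hx hxb
  exact (hx hxb).cexp

end IsPrimitive

end DiracBVP

/-! ### Square integrable kernels: Cauchy–Schwarz, Grönwall, and linear systems -/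

namespace DiracBVP

open Filter Topology

theorem sq_integral_mul_le {X : Type*} [MeasurableSpace X] {m : Measure X} {f g : X → ℝ}
    (hf : MemLp f 2 m) (hg : MemLp g 2 m) :
    (∫ x, f x * g x ∂m) ^ 2 ≤ (∫ x, f x ^ 2 ∂m) * ∫ x, g x ^ 2 ∂m := by
  have h := integral_mul_norm_le_Lp_mul_Lq (μ := m) (f := f) (g := g)
    Real.HolderConjugate.two_two (by simpa using hf) (by simpa using hg)
  have hF : 0 ≤ ∫ x, f x ^ 2 ∂m := integral_nonneg fun x => sq_nonneg _
  have hG : 0 ≤ ∫ x, g x ^ 2 ∂m := integral_nonneg fun x => sq_nonneg _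
  simp only [Real.rpow_two, Real.norm_eq_abs, sq_abs, ← Real.sqrt_eq_rpow] at h
  have h2 : |∫ x, f x * g x ∂m| ≤ ∫ x, |f x| * |g x| ∂m := by
    simpa [abs_mul] using norm_integral_le_integral_norm (μ := m) (fun x => f x * g x)
  calc (∫ x, f x * g x ∂m) ^ 2 = |∫ x, f x * g x ∂m| ^ 2 := (sq_abs _).symm
    _ ≤ (√(∫ x, f x ^ 2 ∂m) * √(∫ x, g x ^ 2 ∂m)) ^ 2 := by
        gcongr
        exact h2.trans h
    _ = _ := by rw [mul_pow, Real.sq_sqrt hF, Real.sq_sqrt hG]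

/-- Cauchy–Schwarz on `[0, x] ⊆ [0, b]`, with the first factor integrated over all of `[0, b]`. -/
theorem sq_intervalIntegral_mul_le {f g : ℝ → ℝ} {b x : ℝ}
    (hf : MemLp f 2 (volume.restrict (Ioc 0 b))) (hx : x ∈ Icc 0 b)
    (hg : MemLp g 2 (volume.restrict (Ioc 0 x))) :
    (∫ t in (0 : ℝ)..x, f t * g t) ^ 2 ≤
      (∫ t in (0 : ℝ)..b, f t ^ 2) * ∫ t in (0 : ℝ)..x, g t ^ 2 := by
  have hsub : Ioc 0 x ⊆ Ioc 0 b := Ioc_subset_Ioc_right hx.2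
  have hfx : MemLp f 2 (volume.restrict (Ioc 0 x)) :=
    hf.mono_measure (Measure.restrict_mono_set _ hsub)
  simp only [intervalIntegral.integral_of_le hx.1,
    intervalIntegral.integral_of_le (hx.1.trans hx.2)]
  refine (sq_integral_mul_le hfx hg).trans ?_
  refine mul_le_mul_of_nonneg_right ?_ (integral_nonneg fun t => sq_nonneg _)
  exact setIntegral_mono_set hf.integrable_sq (Eventually.of_forall fun t => sq_nonneg _)
    hsub.eventuallyLE

theorem memLp_two_of_continuousOn {F : Type*} [NormedAddCommGroup F] {g : ℝ → F}
    {b x : ℝ} (hg : ContinuousOn g (Icc 0 b)) (hx : x ∈ Icc 0 b) :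
    MemLp g 2 (volume.restrict (Ioc 0 x)) := by
  obtain ⟨C, hC⟩ := isCompact_Icc.exists_bound_of_continuousOn hg
  have hsub : Ioc 0 x ⊆ Icc 0 b := (Ioc_subset_Ioc_right hx.2).trans Ioc_subset_Icc_self
  exact MemLp.of_bound ((hg.mono hsub).aestronglyMeasurable measurableSet_Ioc) C
    ((ae_restrict_iff' measurableSet_Ioc).2 (Eventually.of_forall fun t ht => hC t (hsub ht)))

/-- Grönwall's inequality in integral form, with a constant kernel. -/
theorem le_mul_exp_of_le_add_integral {w : ℝ → ℝ} {b m c : ℝ} (hc : 0 ≤ c)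
    (hw : ContinuousOn w (Icc 0 b))
    (h : ∀ x ∈ Icc 0 b, w x ≤ m + c * ∫ t in (0 : ℝ)..x, w t) :
    ∀ x ∈ Icc 0 b, w x ≤ m * Real.exp (c * x) := by
  intro x hx
  rcases hx.1.eq_or_lt with rfl | hx0
  · simpa using h 0 hx
  have hb : 0 ≤ b := hx.1.trans hx.2
  have hwi : IntervalIntegrable w volume 0 b := hw.intervalIntegrable_of_Icc hb
  have hcont : ContinuousOn (fun x => ∫ t in (0 : ℝ)..x, w t) (Icc 0 b) := by
    simpa [uIcc_of_le hb] using
      intervalIntegral.continuousOn_primitive_interval' hwi left_mem_uIcc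
  have hder : ∀ y ∈ Ico 0 b,
      HasDerivWithinAt (fun x => ∫ t in (0 : ℝ)..x, w t) (w y) (Ici y) y := by
    intro y hy
    have hs : 𝓝[>] y = 𝓝[Ioc y b] y := (nhdsWithin_Ioc_eq_nhdsGT hy.2).symm
    refine intervalIntegral.integral_hasDerivWithinAt_right
      (hwi.mono_set (uIcc_subset_uIcc_left (by rw [uIcc_of_le hb]; exact ⟨hy.1, hy.2.le⟩))) ?_ ?_
    · rw [StronglyMeasurableAtFilter, hs]
      exact ⟨Ioc y b, self_mem_nhdsWithin,
        (hw.mono fun z hz => ⟨hy.1.trans hz.1.le, hz.2⟩).aestronglyMeasurable measurableSet_Ioc⟩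
    · rw [ContinuousWithinAt, hs]
      exact (hw y ⟨hy.1, hy.2.le⟩).mono fun z hz => ⟨hy.1.trans hz.1.le, hz.2⟩
  have key := le_gronwallBound_of_liminf_deriv_right_le (δ := 0) (K := c) (ε := m) hcont
    (fun y hy r hr => (hder y hy).liminf_right_slope_le hr) (by simp)
    (fun y hy => by linarith [h y ⟨hy.1, hy.2.le⟩]) x hx
  rw [sub_zero] at key
  rcases hc.eq_or_lt with rfl | hc0
  · simpa using h x hx
  rw [gronwallBound_of_K_ne_0 hc0.ne'] at key
  refine (h x hx).trans ?_
  have : c * (∫ t in (0 : ℝ)..x, w t) ≤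
      c * (0 * Real.exp (c * x) + m / c * (Real.exp (c * x) - 1)) :=
    mul_le_mul_of_nonneg_left key hc
  have e : c * (0 * Real.exp (c * x) + m / c * (Real.exp (c * x) - 1)) =
      m * Real.exp (c * x) - m := by
    field_simp
    ring
  linarith

/-- Grönwall's inequality for a square integrable kernel: the integral term is handled by
Cauchy–Schwarz, so that the square of the function satisfies an inequality with a constant
kernel. -/
theorem sq_le_of_le_add_integral {k v : ℝ → ℝ} {b β : ℝ}
    (hk : MemLp k 2 (volume.restrict (Ioc 0 b))) (hv : ContinuousOn v (Icc 0 b))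
    (hv0 : ∀ x ∈ Icc 0 b, 0 ≤ v x)
    (h : ∀ x ∈ Icc 0 b, v x ≤ β + ∫ t in (0 : ℝ)..x, k t * v t) :
    ∀ x ∈ Icc 0 b, v x ^ 2 ≤ 2 * β ^ 2 * Real.exp (2 * (∫ t in (0 : ℝ)..b, k t ^ 2) * x) := by
  intro x hx
  have hb : 0 ≤ b := hx.1.trans hx.2
  refine le_mul_exp_of_le_add_integral (w := fun x => v x ^ 2) (by
    have : 0 ≤ ∫ t in (0 : ℝ)..b, k t ^ 2 :=
      intervalIntegral.integral_nonneg hb fun t _ => sq_nonneg _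
    positivity) (hv.pow 2) (fun y hy => ?_) x hx
  have h1 := sq_intervalIntegral_mul_le hk hy (memLp_two_of_continuousOn hv hy)
  have h2 := h y hy
  have h3 := hv0 y hy
  nlinarith [sq_nonneg (β - ∫ t in (0 : ℝ)..y, k t * v t)]

section LinearSystem

variable {E : Type*} [NormedAddCommGroup E] [NormedSpace ℝ E] {A : ℝ → E →L[ℝ] E} {b : ℝ}

theorem intervalIntegrable_clm_apply (hb : 0 ≤ b) (hA : MemLp A 2 (volume.restrict (Ioc 0 b)))
    {u : ℝ → E} (hu : ContinuousOn u (Icc 0 b)) :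
    IntervalIntegrable (fun t => A t (u t)) volume 0 b := by
  rw [intervalIntegrable_iff_integrableOn_Ioc_of_le hb]
  obtain ⟨C, hC⟩ := isCompact_Icc.exists_bound_of_continuousOn hu
  have hA1 : Integrable A (volume.restrict (Ioc 0 b)) := hA.integrable (by norm_num)
  refine (hA1.norm.mul_const C).mono'
    ((ContinuousLinearMap.id ℝ (E →L[ℝ] E)).aestronglyMeasurable_comp₂ hA1.aestronglyMeasurable
      ((hu.mono Ioc_subset_Icc_self).aestronglyMeasurable measurableSet_Ioc)) ?_
  refine (ae_restrict_iff' measurableSet_Ioc).2 (Eventually.of_forall fun t ht => ?_)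
  exact (A t).le_of_opNorm_le_of_le le_rfl (hC t (Ioc_subset_Icc_self ht))

variable [CompleteSpace E]

/-- Existence for linear systems `y' = A(t) y` with square integrable coefficient `A`. The
substitution `y = e ^ (c t) u` with `c` large turns the integral equation into a fixed point
equation for a contraction of the space of continuous functions. -/
theorem exists_isPrimitive_clm_apply (hb : 0 ≤ b) (hA : MemLp A 2 (volume.restrict (Ioc 0 b)))
    (y₀ : E) : ∃ y : ℝ → E, y 0 = y₀ ∧ IsPrimitive y (fun t => A t (y t)) 0 b := by
  set K : ℝ := ∫ t in (0 : ℝ)..b, ‖A t‖ ^ 2 with hK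
  have hK0 : 0 ≤ K := intervalIntegral.integral_nonneg hb fun t _ => sq_nonneg _
  set c : ℝ := 2 * K + 1 with hc
  have hc0 : 0 < c := by positivity
  let ext : C(Icc (0 : ℝ) b, E) → ℝ → E := fun u t => Real.exp (c * t) • IccExtend hb u t
  have hext : ∀ u, Continuous (ext u) := fun u =>
    (Real.continuous_exp.comp (continuous_const.mul continuous_id)).smul u.continuous.Icc_extend'
  have hint : ∀ u, IntervalIntegrable (fun t => A t (ext u t)) volume 0 b := fun u =>
    intervalIntegrable_clm_apply hb hA (hext u).continuousOn
  have hprim : ∀ u, ContinuousOn (fun x => ∫ t in (0 : ℝ)..x, A t (ext u t)) (Icc 0 b) := by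
    intro u
    simpa [uIcc_of_le hb] using
      intervalIntegral.continuousOn_primitive_interval' (hint u) left_mem_uIcc
  let S : C(Icc (0 : ℝ) b, E) → C(Icc (0 : ℝ) b, E) := fun u =>
    ⟨fun x => Real.exp (-(c * x)) • (y₀ + ∫ t in (0 : ℝ)..x, A t (ext u t)), by
      refine Continuous.smul (by fun_prop) (continuous_const.add ?_)
      exact continuousOn_iff_continuous_domRestrict.1 (hprim u)⟩
  have hS : ContractingWith (1 / 2) S := by
    refine ⟨by norm_num, LipschitzWith.of_dist_le_mul fun u v => ?_⟩
    rw [ContinuousMap.dist_le (by positivity)]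
    rintro ⟨x, hx⟩
    have hIx : ∀ u, IntervalIntegrable (fun t => A t (ext u t)) volume 0 x := fun u =>
      (hint u).mono_set (uIcc_subset_uIcc_left (by rwa [uIcc_of_le hb]))
    have hexpc : Continuous fun t : ℝ => Real.exp (c * t) := by fun_prop
    have hdiff : ‖∫ t in (0 : ℝ)..x, (A t (ext u t) - A t (ext v t))‖ ≤
        dist u v * ∫ t in (0 : ℝ)..x, ‖A t‖ * Real.exp (c * t) := by
      rw [← intervalIntegral.integral_const_mul]
      refine intervalIntegral.norm_integral_le_of_norm_le hx.1
        (Eventually.of_forall fun t ht => ?_) ?_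
      · have ht' : t ∈ Icc 0 b := ⟨ht.1.le, ht.2.trans hx.2⟩
        rw [← map_sub, ← smul_sub, IccExtend_of_mem hb _ ht', IccExtend_of_mem hb _ ht']
        refine ((A t).le_opNorm _).trans ?_
        rw [norm_smul, Real.norm_eq_abs, abs_of_pos (Real.exp_pos _), ← dist_eq_norm]
        have := ContinuousMap.dist_apply_le_dist (f := u) (g := v) ⟨t, ht'⟩
        calc ‖A t‖ * (Real.exp (c * t) * dist (u ⟨t, ht'⟩) (v ⟨t, ht'⟩))
            ≤ ‖A t‖ * (Real.exp (c * t) * dist u v) := by gcongr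
          _ = _ := by ring
      · have : IntervalIntegrable (fun t => ‖A t‖) volume 0 b := by
          rw [intervalIntegrable_iff_integrableOn_Ioc_of_le hb]
          exact (hA.integrable (by norm_num)).norm
        exact ((this.mul_continuousOn hexpc.continuousOn).mono_set
          (uIcc_subset_uIcc_left (by rwa [uIcc_of_le hb]))).const_mul _
    have hker : ∫ t in (0 : ℝ)..x, ‖A t‖ * Real.exp (c * t) ≤ 1 / 2 * Real.exp (c * x) := by
      have h1 := sq_intervalIntegral_mul_le hA.norm hx
        (memLp_two_of_continuousOn (hexpc.continuousOn (s := Icc 0 b)) hx)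
      have h2 : ∫ t in (0 : ℝ)..x, Real.exp (c * t) ^ 2 = (Real.exp (2 * c * x) - 1) / (2 * c) := by
        have : ∀ t, Real.exp (c * t) ^ 2 = Real.exp (2 * c * t) := fun t => by
          rw [← Real.exp_nat_mul]; congr 1; push_cast; ring
        simp only [this]
        rw [intervalIntegral.integral_comp_mul_left _ (by positivity), integral_exp]
        simp [div_eq_inv_mul]
      have h3 : Real.exp (2 * c * x) = Real.exp (c * x) ^ 2 := by
        rw [← Real.exp_nat_mul]; congr 1; push_cast; ring
      rw [h2, h3, ← hK] at h1
      refine abs_le_of_sq_le_sq' ?_ (by positivity) |>.2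
      refine h1.trans ?_
      rw [mul_div_assoc', div_le_iff₀ (by positivity)]
      nlinarith [sq_nonneg (Real.exp (c * x))]
    have e : S u ⟨x, hx⟩ - S v ⟨x, hx⟩ =
        Real.exp (-(c * x)) • ∫ t in (0 : ℝ)..x, (A t (ext u t) - A t (ext v t)) := by
      rw [intervalIntegral.integral_sub (hIx u) (hIx v)]
      simp only [S, ContinuousMap.coe_mk, ← smul_sub]
      congr 1
      abel
    rw [dist_eq_norm, e, norm_smul, Real.norm_eq_abs, abs_of_pos (Real.exp_pos _)]
    have hd : 0 ≤ dist u v := dist_nonneg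
    calc Real.exp (-(c * x)) * ‖∫ t in (0 : ℝ)..x, (A t (ext u t) - A t (ext v t))‖
        ≤ Real.exp (-(c * x)) * (dist u v * (1 / 2 * Real.exp (c * x))) := by
          gcongr
          exact hdiff.trans (by gcongr)
      _ = ((1 / 2 : NNReal) : ℝ) * dist u v * (Real.exp (-(c * x)) * Real.exp (c * x)) := by
          push_cast; ring
      _ = _ := by rw [← Real.exp_add]; simp
  have : Nonempty C(Icc (0 : ℝ) b, E) := ⟨0⟩
  let u := hS.fixedPoint S
  have hu : S u = u := hS.fixedPoint_isFixedPt
  have hmain : ∀ x ∈ Icc 0 b, y₀ + ∫ t in (0 : ℝ)..x, A t (ext u t) = ext u x := by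
    intro x hx
    have h1 : S u ⟨x, hx⟩ = u ⟨x, hx⟩ := by rw [hu]
    simp only [ext, IccExtend_of_mem hb _ hx]
    rw [← h1]
    simp only [S, ContinuousMap.coe_mk]
    rw [smul_smul, ← Real.exp_add]
    simp [ext]
  refine ⟨fun x => y₀ + ∫ t in (0 : ℝ)..x, A t (ext u t), by simp, ?_⟩
  have hp := IsPrimitive.of_integral (hint u) y₀
  have hcongr : ∀ t ∈ uIcc 0 b, A t (ext u t) = A t (y₀ + ∫ s in (0 : ℝ)..t, A s (ext u s)) := by
    intro t ht
    rw [hmain t (by rwa [uIcc_of_le hb] at ht)]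
  refine ⟨hp.absolutelyContinuous, hp.intervalIntegrable.congr fun t ht =>
    hcongr t (uIoc_subset_uIcc ht), ?_⟩
  filter_upwards [hp.ae_hasDerivAt] with t ht htb
  rw [← hcongr t htb]
  exact ht htb

/-- Growth of solutions of inhomogeneous linear systems. -/
theorem norm_sq_le_of_isPrimitive {f : ℝ → E} {y : ℝ → E} {k : ℝ → ℝ} {β : ℝ}
    (hk : MemLp k 2 (volume.restrict (Ioc 0 b)))
    (hAk : ∀ t ∈ Icc 0 b, ‖A t‖ ≤ k t) (hA : MemLp A 2 (volume.restrict (Ioc 0 b)))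
    (hf : IntervalIntegrable f volume 0 b)
    (hy : IsPrimitive y (fun t => A t (y t) + f t) 0 b)
    (hβ : ‖y 0‖ + ∫ t in (0 : ℝ)..b, ‖f t‖ ≤ β) :
    ∀ x ∈ Icc 0 b, ‖y x‖ ^ 2 ≤ 2 * β ^ 2 * Real.exp (2 * (∫ t in (0 : ℝ)..b, k t ^ 2) * x) := by
  intro x hx
  have hb : 0 ≤ b := hx.1.trans hx.2
  have hyc : ContinuousOn y (Icc 0 b) := by simpa [uIcc_of_le hb] using hy.continuousOn
  refine sq_le_of_le_add_integral hk hyc.norm (fun _ _ => norm_nonneg _) (fun x hx => ?_) x hx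
  have hxu : uIcc 0 x ⊆ uIcc 0 b := uIcc_subset_uIcc_left (by rwa [uIcc_of_le hb])
  have hAi := (intervalIntegrable_clm_apply hb hA hyc).mono_set hxu
  rw [hy.eq_add_integral x (by rwa [uIcc_of_le hb]),
    intervalIntegral.integral_add hAi (hf.mono_set hxu)]
  have h1 : ‖∫ t in (0 : ℝ)..x, A t (y t)‖ ≤ ∫ t in (0 : ℝ)..x, k t * ‖y t‖ := by
    refine intervalIntegral.norm_integral_le_of_norm_le hx.1
      (Eventually.of_forall fun t ht => ?_) ?_
    · exact (A t).le_of_opNorm_le (hAk t ⟨ht.1.le, ht.2.trans hx.2⟩) _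
    · have : IntervalIntegrable k volume 0 b := by
        rw [intervalIntegrable_iff_integrableOn_Ioc_of_le hb]
        exact hk.integrable (by norm_num)
      exact (this.mul_continuousOn (by simpa [uIcc_of_le hb] using hyc.norm)).mono_set hxu
  have h2 : ‖∫ t in (0 : ℝ)..x, f t‖ ≤ ∫ t in (0 : ℝ)..b, ‖f t‖ := by
    refine (intervalIntegral.norm_integral_le_integral_norm hx.1).trans ?_
    exact intervalIntegral.integral_mono_interval le_rfl hx.1 hx.2
      (Eventually.of_forall fun _ => norm_nonneg _) hf.norm
  calc _ ≤ ‖y 0‖ + (‖∫ t in (0 : ℝ)..x, A t (y t)‖ + ‖∫ t in (0 : ℝ)..x, f t‖) :=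
        (norm_add_le _ _).trans (by gcongr; exact norm_add_le _ _)
    _ ≤ _ := by linarith

theorem eqOn_of_isPrimitive_clm_apply (hA : MemLp A 2 (volume.restrict (Ioc 0 b)))
    {y w : ℝ → E} (hy : IsPrimitive y (fun t => A t (y t)) 0 b)
    (hw : IsPrimitive w (fun t => A t (w t)) 0 b) (h0 : y 0 = w 0) :
    ∀ x ∈ Icc 0 b, y x = w x := by
  intro x hx
  have hd := (hy.sub hw).congr (g' := fun t => A t (y t - w t) + 0) fun t => by
    rw [map_sub, add_zero]
  have := norm_sq_le_of_isPrimitive hA.norm (fun t _ => le_rfl) hA (f := fun _ => 0)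
    intervalIntegrable_const hd (β := 0) (by simp [h0]) x hx
  have h2 : ‖y x - w x‖ ^ 2 ≤ 0 := by simpa using this
  have h3 : ‖y x - w x‖ = 0 := by nlinarith [norm_nonneg (y x - w x)]
  exact sub_eq_zero.1 (norm_eq_zero.1 h3)

end LinearSystem

end DiracBVP

/-! ### The Dirac system as a linear system with square integrable coefficients -/

namespace DiracBVP

open Filter Topology

/-- The standing assumptions on the coefficients of the system. Square integrability is stated on
`(0, π]`, over which the interval integrals are taken. -/
structure Admissible (p q : ℝ → ℝ) (a α : ℝ) : Prop where
  memLp_p : MemLp p 2 (volume.restrict (Ioc (0 : ℝ) π))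
  memLp_q : MemLp q 2 (volume.restrict (Ioc (0 : ℝ) π))
  nonneg : 0 ≤ a
  le_pi : a ≤ π
  pos : 0 < α

section Weight

variable {a α : ℝ}

theorem rho_pos (hα : 0 < α) (x : ℝ) : 0 < rho a α x := by
  unfold rho; split_ifs <;> linarith

theorem rho_le (hα : 0 < α) (x : ℝ) : rho a α x ≤ 1 + α := by
  unfold rho; split_ifs <;> linarith

theorem norm_rho_le (hα : 0 < α) (x : ℝ) : ‖(rho a α x : ℂ)‖ ≤ 1 + α := by
  rw [Complex.norm_real, Real.norm_eq_abs, abs_of_pos (rho_pos hα x)]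
  exact rho_le hα x

theorem measurable_rho : Measurable (rho a α) :=
  Measurable.ite measurableSet_Iic measurable_const measurable_const

theorem memLp_rho (hα : 0 < α) (x : ℝ) :
    MemLp (rho a α) 2 (volume.restrict (Ioc (0 : ℝ) x)) :=
  MemLp.of_bound measurable_rho.aestronglyMeasurable (1 + α) (Eventually.of_forall fun t => by
    simpa using norm_rho_le (a := a) hα t)

theorem intervalIntegrable_rho (hα : 0 < α) (c d : ℝ) :
    IntervalIntegrable (rho a α) volume c d := by
  rw [intervalIntegrable_iff]
  exact Measure.integrableOn_of_bounded (M := 1 + α) (by simp)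
    measurable_rho.aestronglyMeasurable (Eventually.of_forall fun t => by
      simpa using norm_rho_le (a := a) hα t)

theorem mu_zero (ha : 0 ≤ a) : mu a α 0 = 0 := by simp [mu, ha]

theorem mu_eq_max_min (x : ℝ) : mu a α x = min x a + α * max (x - a) 0 := by
  unfold mu
  split_ifs with h
  · rw [min_eq_left h, max_eq_right (by linarith)]; ring
  · rw [min_eq_right (by linarith), max_eq_left (by linarith)]; ring

theorem continuous_mu : Continuous (mu a α) := by
  rw [show mu a α = fun x => min x a + α * max (x - a) 0 from funext mu_eq_max_min]
  fun_prop

theorem mu_mono (hα : 0 < α) {x y : ℝ} (h : x ≤ y) : mu a α x ≤ mu a α y := by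
  rw [mu_eq_max_min, mu_eq_max_min]
  gcongr

theorem mu_sub_le (hα : 0 < α) {x y : ℝ} (h : x ≤ y) :
    mu a α y - mu a α x ≤ (1 + α) * (y - x) := by
  unfold mu
  split_ifs <;> nlinarith

theorem mu_nonneg (ha : 0 ≤ a) (hα : 0 < α) {x : ℝ} (hx : 0 ≤ x) : 0 ≤ mu a α x := by
  simpa [mu_zero ha] using mu_mono (a := a) hα hx

theorem mu_pi_pos (ha : 0 ≤ a) (hα : 0 < α) : 0 < mu a α π := by
  unfold mu
  split_ifs with h
  · exact Real.pi_pos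
  · nlinarith [mul_pos hα (sub_pos.2 (not_le.1 h))]

theorem isPrimitive_mu (hα : 0 < α) (c d : ℝ) :
    IsPrimitive (fun x => (mu a α x : ℂ)) (fun x => (rho a α x : ℂ)) c d where
  absolutelyContinuous := by
    have hlip : LipschitzOnWith (Real.toNNReal (1 + α)) (fun x => (mu a α x : ℂ)) (uIcc c d) := by
      refine LipschitzOnWith.of_dist_le_mul fun x _ y _ => ?_
      rw [Complex.dist_of_im_eq (by simp), Real.coe_toNNReal _ (by linarith), Complex.ofReal_re,
        Complex.ofReal_re, Real.dist_eq, Real.dist_eq]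
      rcases le_total x y with h | h
      · rw [abs_sub_comm, abs_of_nonneg (sub_nonneg.2 (mu_mono hα h)), abs_sub_comm,
          abs_of_nonneg (sub_nonneg.2 h)]
        exact mu_sub_le hα h
      · rw [abs_of_nonneg (sub_nonneg.2 (mu_mono hα h)), abs_of_nonneg (sub_nonneg.2 h)]
        exact mu_sub_le hα h
    exact hlip.absolutelyContinuousOnInterval
  intervalIntegrable :=
    ⟨(intervalIntegrable_rho hα c d).1.ofReal, (intervalIntegrable_rho hα c d).2.ofReal⟩
  ae_hasDerivAt := by
    have hne : ∀ᵐ x : ℝ, x ≠ a := by simp [ae_iff, measure_singleton]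
    filter_upwards [hne] with x hx _
    refine HasDerivAt.ofReal_comp ?_
    rcases lt_or_gt_of_ne hx with h | h
    · have : rho a α x = 1 := if_pos h.le
      rw [this]
      refine (hasDerivAt_id x).congr_of_eventuallyEq ?_
      filter_upwards [Iio_mem_nhds h] with y hy
      exact if_pos (le_of_lt hy)
    · have : rho a α x = α := if_neg (not_le.2 h)
      rw [this]
      have h1 : HasDerivAt (fun y : ℝ => α * y - α * a + a) α x := by
        simpa using (((hasDerivAt_id x).const_mul α).sub_const (α * a)).add_const a
      refine h1.congr_of_eventuallyEq ?_
      filter_upwards [Ioi_mem_nhds h] with y hy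
      exact if_neg (not_le.2 hy)

end Weight

/-- The rotation `y ↦ (-z y₂, z y₁)`, i.e. multiplication by the matrix `-z B`. -/
noncomputable def rotation (z : ℂ) : ℂ × ℂ →L[ℝ] ℂ × ℂ :=
  (-((ContinuousLinearMap.mul ℝ ℂ z).comp (ContinuousLinearMap.snd ℝ ℂ ℂ))).prod
    ((ContinuousLinearMap.mul ℝ ℂ z).comp (ContinuousLinearMap.fst ℝ ℂ ℂ))

theorem rotation_apply (z : ℂ) (y : ℂ × ℂ) : rotation z y = (-(z * y.2), z * y.1) := rfl

theorem norm_rotation_le (z : ℂ) : ‖rotation z‖ ≤ ‖z‖ := by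
  refine ContinuousLinearMap.opNorm_le_bound _ (norm_nonneg _) fun y => ?_
  rw [rotation_apply, Prod.norm_def, Prod.norm_def, norm_neg, norm_mul, norm_mul, max_comm,
    mul_max_of_nonneg _ _ (norm_nonneg z)]

/-- The coefficient of the Dirac system, solved for the derivative: `B y' + Ω y = z ρ y` becomes
`y' = (q y₁ - (p + z ρ) y₂, (z ρ - p) y₁ - q y₂)`. -/
noncomputable def coeff (p q : ℝ → ℝ) (a α : ℝ) (z : ℂ) (t : ℝ) : ℂ × ℂ →L[ℝ] ℂ × ℂ :=
  q t • (ContinuousLinearMap.fst ℝ ℂ ℂ).prod (-ContinuousLinearMap.snd ℝ ℂ ℂ) +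
    p t • (-ContinuousLinearMap.snd ℝ ℂ ℂ).prod (-ContinuousLinearMap.fst ℝ ℂ ℂ) +
    rho a α t • rotation z

section System

variable {p q : ℝ → ℝ} {a α : ℝ}

theorem memLp_smul_const {F : Type*} [NormedAddCommGroup F] [NormedSpace ℝ F] {r : ℝ → ℝ}
    {m : Measure ℝ} (hr : MemLp r 2 m) (T : F) : MemLp (fun t => r t • T) 2 m := by
  refine (hr.norm.mul_const ‖T‖).of_le (hr.aestronglyMeasurable.smul_const T)
    (Eventually.of_forall fun t => ?_)
  simp [norm_smul]

theorem coeff_apply (z : ℂ) (t : ℝ) (y : ℂ × ℂ) :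
    coeff p q a α z t y =
      (q t * y.1 - (p t + z * rho a α t) * y.2, (z * rho a α t - p t) * y.1 - q t * y.2) := by
  simp only [coeff, _root_.add_apply, _root_.smul_apply,
    ContinuousLinearMap.prod_apply, _root_.neg_apply, ContinuousLinearMap.coe_fst',
    ContinuousLinearMap.coe_snd', rotation_apply, Prod.smul_mk, Prod.mk_add_mk, Complex.real_smul]
  ext <;> ring_nf

namespace Admissible

variable (H : Admissible p q a α)
include H

theorem memLp_coeff (z : ℂ) : MemLp (coeff p q a α z) 2 (volume.restrict (Ioc 0 π)) := by
  have h1 := memLp_smul_const H.memLp_q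
    ((ContinuousLinearMap.fst ℝ ℂ ℂ).prod (-ContinuousLinearMap.snd ℝ ℂ ℂ))
  have h2 := memLp_smul_const H.memLp_p
    ((-ContinuousLinearMap.snd ℝ ℂ ℂ).prod (-ContinuousLinearMap.fst ℝ ℂ ℂ))
  have h3 := memLp_smul_const (memLp_rho (a := a) H.pos π) (rotation z)
  refine MemLp.ae_eq (Eventually.of_forall fun t => ?_) ((h1.add h2).add h3)
  simp only [coeff, Pi.add_apply]

theorem isSolution_iff {z : ℂ} {y : ℝ → ℂ × ℂ} :
    IsSolution p q a α z y ↔ IsPrimitive y (fun t => coeff p q a α z t (y t)) 0 π := by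
  have hpi : (0 : ℝ) ≤ π := Real.pi_pos.le
  have hsolve : ∀ (x : ℝ) (y' : ℂ × ℂ),
      (y'.2 + (p x : ℂ) * (y x).1 + (q x : ℂ) * (y x).2 = z * (rho a α x : ℂ) * (y x).1 ∧
        -y'.1 + (q x : ℂ) * (y x).1 - (p x : ℂ) * (y x).2 = z * (rho a α x : ℂ) * (y x).2) ↔
      y' = coeff p q a α z x (y x) := by
    intro x y'
    rw [coeff_apply, Prod.ext_iff]
    constructor
    · rintro ⟨h1, h2⟩
      exact ⟨by linear_combination -h2, by linear_combination h1⟩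
    · rintro ⟨h1, h2⟩
      exact ⟨by linear_combination h2, by linear_combination -h1⟩
  have hae : (∀ᵐ x ∂(volume.restrict (Ioo (0 : ℝ) π)),
      HasDerivAt y (coeff p q a α z x (y x)) x) ↔
      ∀ᵐ x, x ∈ uIcc 0 π → HasDerivAt y (coeff p q a α z x (y x)) x := by
    rw [uIcc_of_le hpi, Measure.restrict_congr_set Ioo_ae_eq_Icc,
      ae_restrict_iff' measurableSet_Icc]
  constructor
  · rintro ⟨h1, h2⟩
    refine ⟨h1, intervalIntegrable_clm_apply hpi (H.memLp_coeff z)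
      (by simpa [uIcc_of_le hpi] using h1.continuousOn), hae.1 ?_⟩
    filter_upwards [h2] with x ⟨y', hy', he⟩
    rwa [← (hsolve x y').1 he]
  · rintro ⟨h1, -, h3⟩
    refine ⟨h1, ?_⟩
    filter_upwards [hae.2 h3] with x hx
    exact ⟨_, hx, (hsolve x _).2 rfl⟩

theorem exists_isSolution (z : ℂ) (y₀ : ℂ × ℂ) :
    ∃ y, IsSolution p q a α z y ∧ y 0 = y₀ := by
  obtain ⟨y, hy0, hy⟩ := exists_isPrimitive_clm_apply Real.pi_pos.le (H.memLp_coeff z) y₀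
  exact ⟨y, H.isSolution_iff.2 hy, hy0⟩

theorem eqOn_of_isSolution {z : ℂ} {y w : ℝ → ℂ × ℂ} (hy : IsSolution p q a α z y)
    (hw : IsSolution p q a α z w) (h0 : y 0 = w 0) : ∀ x ∈ Icc 0 π, y x = w x :=
  eqOn_of_isPrimitive_clm_apply (H.memLp_coeff z) (H.isSolution_iff.1 hy) (H.isSolution_iff.1 hw) h0

theorem phi_spec (z : ℂ) :
    IsSolution p q a α z (phi p q a α z) ∧ phi p q a α z 0 = (0, -1) :=
  Classical.epsilon_spec (H.exists_isSolution z (0, -1))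

theorem isPrimitive_phi (z : ℂ) :
    IsPrimitive (phi p q a α z) (fun t => coeff p q a α z t (phi p q a α z t)) 0 π :=
  H.isSolution_iff.1 (H.phi_spec z).1

theorem continuousOn_phi (z : ℂ) : ContinuousOn (phi p q a α z) (Icc 0 π) := by
  simpa [uIcc_of_le Real.pi_pos.le] using (H.isPrimitive_phi z).continuousOn

/-- A solution with `y₁(0) = 0` is a multiple of `φ`. -/
theorem eq_smul_phi {z : ℂ} {y : ℝ → ℂ × ℂ} (hy : IsSolution p q a α z y) (h0 : (y 0).1 = 0) :
    ∀ x ∈ Icc 0 π, y x = (-(y 0).2) • phi p q a α z x := by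
  refine H.eqOn_of_isSolution hy (w := fun x => (-(y 0).2) • phi p q a α z x)
    (H.isSolution_iff.2 ?_) ?_
  · have h := (H.isPrimitive_phi z).clm_comp
      ((-(y 0).2) • ContinuousLinearMap.id ℝ (ℂ × ℂ))
    refine h.congr fun t => ?_
    simp only [_root_.smul_apply, ContinuousLinearMap.id_apply, coeff_apply]
    ext <;> simp <;> ring
  · rw [(H.phi_spec z).2]
    ext <;> simp [h0]

/-- Complex conjugation turns solutions for `z` into solutions for `conj z`, as the coefficients
are real. -/
theorem phi_conj (z : ℂ) : ∀ x ∈ Icc 0 π,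
    phi p q a α (starRingEnd ℂ z) x =
      (starRingEnd ℂ (phi p q a α z x).1, starRingEnd ℂ (phi p q a α z x).2) := by
  refine H.eqOn_of_isSolution (H.phi_spec _).1
    (w := fun x => (starRingEnd ℂ (phi p q a α z x).1, starRingEnd ℂ (phi p q a α z x).2))
    (H.isSolution_iff.2 ?_) ?_
  · have h := (H.isPrimitive_phi z).clm_comp
      (((Complex.conjCLE : ℂ →L[ℝ] ℂ).comp (ContinuousLinearMap.fst ℝ ℂ ℂ)).prod
        ((Complex.conjCLE : ℂ →L[ℝ] ℂ).comp (ContinuousLinearMap.snd ℝ ℂ ℂ)))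
    refine h.congr fun t => ?_
    simp [coeff_apply]
  · simp [(H.phi_spec _).2]

/-- Lagrange's identity for solutions of the system with the parameters `z` and `w`. -/
theorem lagrange {z w : ℂ} {y u : ℝ → ℂ × ℂ} (hy : IsSolution p q a α z y)
    (hu : IsSolution p q a α w u) : ∀ x ∈ Icc 0 π,
    (y x).1 * (u x).2 - (y x).2 * (u x).1 = (y 0).1 * (u 0).2 - (y 0).2 * (u 0).1 +
      (w - z) * ∫ t in (0 : ℝ)..x, (rho a α t : ℂ) * ((y t).1 * (u t).1 + (y t).2 * (u t).2) := by
  intro x hx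
  have hy' := H.isSolution_iff.1 hy
  have hu' := H.isSolution_iff.1 hu
  have h1 := hy'.clm_comp (ContinuousLinearMap.fst ℝ ℂ ℂ)
  have h2 := hy'.clm_comp (ContinuousLinearMap.snd ℝ ℂ ℂ)
  have k1 := hu'.clm_comp (ContinuousLinearMap.fst ℝ ℂ ℂ)
  have k2 := hu'.clm_comp (ContinuousLinearMap.snd ℝ ℂ ℂ)
  have h := ((h1.mul k2).sub (h2.mul k1)).congr (g' := fun t =>
    (w - z) * ((rho a α t : ℂ) * ((y t).1 * (u t).1 + (y t).2 * (u t).2))) fun t => by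
      simp only [ContinuousLinearMap.coe_fst', ContinuousLinearMap.coe_snd', coeff_apply]
      ring
  have := h.eq_add_integral x (by rwa [uIcc_of_le Real.pi_pos.le])
  rw [intervalIntegral.integral_const_mul] at this
  exact this

/-- `φ(x, z)` depends on `z` in a locally Lipschitz way, uniformly in `x`. -/
theorem exists_norm_phi_sub_le (z₀ : ℂ) : ∃ C : ℝ, 0 ≤ C ∧ ∀ z, ‖z - z₀‖ ≤ 1 → ∀ x ∈ Icc 0 π,
    ‖phi p q a α z x - phi p q a α z₀ x‖ ≤ C * ‖z - z₀‖ := by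
  have hpi : (0 : ℝ) ≤ π := Real.pi_pos.le
  set k : ℝ → ℝ := fun t => ‖coeff p q a α z₀ t‖ + rho a α t with hk
  have hkL : MemLp k 2 (volume.restrict (Ioc 0 π)) :=
    (H.memLp_coeff z₀).norm.add (memLp_rho H.pos π)
  obtain ⟨M, hM⟩ := isCompact_Icc.exists_bound_of_continuousOn (H.continuousOn_phi z₀)
  have hM0 : 0 ≤ M := (norm_nonneg _).trans (hM 0 ⟨le_rfl, hpi⟩)
  have hα := H.pos
  set D : ℝ := π * ((1 + α) * M) with hD
  set X : ℝ := Real.exp (2 * (∫ t in (0 : ℝ)..π, k t ^ 2) * π) with hX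
  refine ⟨√(2 * D ^ 2 * X), Real.sqrt_nonneg _, fun z hz x hx => ?_⟩
  have hadd : ∀ t, coeff p q a α z t = coeff p q a α z₀ t + rho a α t • rotation (z - z₀) := by
    intro t
    refine ContinuousLinearMap.ext fun v => ?_
    simp only [_root_.add_apply, _root_.smul_apply, coeff_apply,
      rotation_apply]
    ext <;> simp <;> ring
  have hbound : ∀ t ∈ Icc 0 π, ‖coeff p q a α z t‖ ≤ k t := by
    intro t _
    rw [hadd]
    refine (norm_add_le _ _).trans (add_le_add le_rfl ?_)
    rw [norm_smul, Real.norm_eq_abs, abs_of_pos (rho_pos hα t)]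
    exact mul_le_of_le_one_right (rho_pos hα t).le ((norm_rotation_le _).trans hz)
  set f : ℝ → ℂ × ℂ := fun t => rho a α t • rotation (z - z₀) (phi p q a α z₀ t) with hf
  have hfle : ∀ t ∈ Icc 0 π, ‖f t‖ ≤ (1 + α) * M * ‖z - z₀‖ := by
    intro t ht
    rw [hf, norm_smul, Real.norm_eq_abs, abs_of_pos (rho_pos hα t), mul_assoc]
    refine mul_le_mul (rho_le hα t) ?_ (norm_nonneg _) (by positivity)
    rw [mul_comm M]
    exact (rotation (z - z₀)).le_of_opNorm_le_of_le (norm_rotation_le _) (hM t ht)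
  have hfi : IntervalIntegrable f volume 0 π := by
    refine (intervalIntegrable_rho hα 0 π).smul_continuousOn ?_
    rw [uIcc_of_le hpi]
    exact (rotation (z - z₀)).continuous.comp_continuousOn (H.continuousOn_phi z₀)
  have hd : IsPrimitive (fun t => phi p q a α z t - phi p q a α z₀ t)
      (fun t => coeff p q a α z t (phi p q a α z t - phi p q a α z₀ t) + f t) 0 π := by
    refine ((H.isPrimitive_phi z).sub (H.isPrimitive_phi z₀)).congr fun t => ?_
    rw [map_sub, hadd t]
    simp only [hf, _root_.add_apply, _root_.smul_apply]
    abel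
  have hβ : ‖phi p q a α z 0 - phi p q a α z₀ 0‖ + ∫ t in (0 : ℝ)..π, ‖f t‖ ≤ D * ‖z - z₀‖ := by
    rw [(H.phi_spec z).2, (H.phi_spec z₀).2, sub_self, norm_zero, zero_add]
    have := intervalIntegral.integral_mono_on hpi hfi.norm
      (intervalIntegrable_const (c := (1 + α) * M * ‖z - z₀‖)) hfle
    rw [intervalIntegral.integral_const, sub_zero, smul_eq_mul] at this
    refine this.trans_eq ?_
    rw [hD]; ring
  have hmain := norm_sq_le_of_isPrimitive hkL hbound (H.memLp_coeff z) hfi hd hβ x hx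
  have hI : 0 ≤ ∫ t in (0 : ℝ)..π, k t ^ 2 :=
    intervalIntegral.integral_nonneg hpi fun t _ => sq_nonneg _
  have hexp : Real.exp (2 * (∫ t in (0 : ℝ)..π, k t ^ 2) * x) ≤ X := by
    rw [hX]
    gcongr
    exact hx.2
  refine abs_le_of_sq_le_sq' ?_ (by positivity) |>.2
  rw [mul_pow, Real.sq_sqrt (by positivity)]
  refine hmain.trans ?_
  calc 2 * (D * ‖z - z₀‖) ^ 2 * Real.exp (2 * (∫ t in (0 : ℝ)..π, k t ^ 2) * x)
      ≤ 2 * (D * ‖z - z₀‖) ^ 2 * X := by gcongr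
    _ = _ := by ring

theorem continuous_phi_apply {x : ℝ} (hx : x ∈ Icc 0 π) :
    Continuous fun z => phi p q a α z x := by
  refine continuous_iff_continuousAt.2 fun z₀ => ?_
  obtain ⟨C, -, hC⟩ := H.exists_norm_phi_sub_le z₀
  refine tendsto_iff_norm_sub_tendsto_zero.2 ?_
  have h0 : Tendsto (fun z => C * ‖z - z₀‖) (𝓝 z₀) (𝓝 0) := by
    have : Continuous fun z : ℂ => C * ‖z - z₀‖ := by fun_prop
    simpa using this.tendsto z₀
  refine squeeze_zero' (Eventually.of_forall fun _ => norm_nonneg _) ?_ h0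
  filter_upwards [Metric.closedBall_mem_nhds z₀ one_pos] with z hz
  exact hC z (by simpa [dist_eq_norm] using hz) x hx

theorem continuous_integral_phi_mul {u : ℝ → ℂ × ℂ} (hu : ContinuousOn u (Icc 0 π)) :
    Continuous fun z => ∫ t in (0 : ℝ)..π,
      (rho a α t : ℂ) * ((phi p q a α z t).1 * (u t).1 + (phi p q a α z t).2 * (u t).2) := by
  have hpi : (0 : ℝ) ≤ π := Real.pi_pos.le
  refine continuous_iff_continuousAt.2 fun z₀ => ?_
  obtain ⟨C, hC0, hC⟩ := H.exists_norm_phi_sub_le z₀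
  obtain ⟨M, hM⟩ := isCompact_Icc.exists_bound_of_continuousOn (H.continuousOn_phi z₀)
  obtain ⟨N, hN⟩ := isCompact_Icc.exists_bound_of_continuousOn hu
  have hα := H.pos
  refine intervalIntegral.continuousAt_of_dominated_interval
    (bound := fun _ => (1 + α) * ((C + M) * N + (C + M) * N)) ?_ ?_ intervalIntegrable_const ?_
  · refine Eventually.of_forall fun z => ?_
    rw [uIoc_of_le hpi]
    have h1 := (H.continuousOn_phi z).mono (Ioc_subset_Icc_self)
    have h2 := hu.mono (Ioc_subset_Icc_self)
    have h3 : AEStronglyMeasurable (fun t => (rho a α t : ℂ)) (volume.restrict (Ioc 0 π)) :=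
      (Complex.measurable_ofReal.comp measurable_rho).aestronglyMeasurable
    exact h3.mul (((h1.fst.mul h2.fst).add (h1.snd.mul h2.snd)).aestronglyMeasurable
      measurableSet_Ioc)
  · filter_upwards [Metric.closedBall_mem_nhds z₀ one_pos] with z hz
    refine Eventually.of_forall fun t ht => ?_
    rw [uIoc_of_le hpi] at ht
    have ht' := Ioc_subset_Icc_self ht
    have hz' : ‖z - z₀‖ ≤ 1 := by simpa [dist_eq_norm] using hz
    have hb : ‖phi p q a α z t‖ ≤ C + M := by
      have h1 := norm_le_norm_sub_add (phi p q a α z t) (phi p q a α z₀ t)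
      have h2 := hC z hz' t ht'
      have h3 := hM t ht'
      nlinarith
    have hb1 := (norm_fst_le _).trans hb
    have hb2 := (norm_snd_le _).trans hb
    have hu1 := (norm_fst_le _).trans (hN t ht')
    have hu2 := (norm_snd_le _).trans (hN t ht')
    have hCM : 0 ≤ C + M := (norm_nonneg _).trans hb
    rw [norm_mul]
    refine mul_le_mul (norm_rho_le hα t) ((norm_add_le _ _).trans ?_) (norm_nonneg _)
      (by positivity)
    rw [norm_mul, norm_mul]
    gcongr
  · refine Eventually.of_forall fun t ht => ?_
    rw [uIoc_of_le hpi] at ht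
    have h := H.continuous_phi_apply (Ioc_subset_Icc_self ht)
    exact (continuous_const.mul ((h.fst.mul continuous_const).add
      (h.snd.mul continuous_const))).continuousAt

end Admissible

end System

end DiracBVP

/-! ### The characteristic function: analyticity, reality and simplicity of its zeros -/

namespace DiracBVP

open Filter Topology

theorem hasDerivAt_of_eq_add_sub_mul {f K : ℂ → ℂ} {z₀ c : ℂ} (hK : ContinuousAt K z₀)
    (hf : ∀ z, f z = c + (z - z₀) * K z) : HasDerivAt f (K z₀) z₀ := by
  rw [hasDerivAt_iff_tendsto_slope]
  refine (hK.tendsto.mono_left nhdsWithin_le_nhds).congr' ?_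
  filter_upwards [self_mem_nhdsWithin] with z hz
  have hz' : z - z₀ ≠ 0 := sub_ne_zero.2 hz
  rw [slope_def_field, hf z, hf z₀]
  field_simp
  ring

namespace Admissible

variable {p q : ℝ → ℝ} {a α : ℝ} (H : Admissible p q a α)
include H

/-- Together with a solution starting at `(1, 0)`, the solution `φ` forms a fundamental system
with Wronskian `1`. -/
theorem exists_wronskian_eq_one (z : ℂ) : ∃ u, IsSolution p q a α z u ∧ u 0 = (1, 0) ∧
    ∀ x ∈ Icc 0 π, (phi p q a α z x).1 * (u x).2 - (phi p q a α z x).2 * (u x).1 = 1 := by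
  obtain ⟨u, hu, hu0⟩ := H.exists_isSolution z (1, 0)
  refine ⟨u, hu, hu0, fun x hx => ?_⟩
  rw [H.lagrange (H.phi_spec z).1 hu x hx, (H.phi_spec z).2, hu0]
  simp

theorem phi_ne_zero (z : ℂ) {x : ℝ} (hx : x ∈ Icc 0 π) : phi p q a α z x ≠ 0 := by
  obtain ⟨u, -, -, hu⟩ := H.exists_wronskian_eq_one z
  intro h0
  have := hu x hx
  rw [h0] at this
  simp at this

/-- `z ↦ φ(π, z)` is entire: by Lagrange's identity, the Wronskians of `φ(·, z)` with a fixed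
fundamental system for `z₀` are differentiable at `z₀`. -/
theorem differentiable_phi_pi :
    Differentiable ℂ (fun z => (phi p q a α z π).1) ∧
      Differentiable ℂ (fun z => (phi p q a α z π).2) := by
  have hmem : π ∈ Icc 0 π := ⟨Real.pi_pos.le, le_rfl⟩
  have key : ∀ z₀, DifferentiableAt ℂ (fun z => (phi p q a α z π).1) z₀ ∧
      DifferentiableAt ℂ (fun z => (phi p q a α z π).2) z₀ := by
    intro z₀
    obtain ⟨u, hu, hu0, hW⟩ := H.exists_wronskian_eq_one z₀
    have hW := hW π hmem
    have hwr : ∀ v, IsSolution p q a α z₀ v → DifferentiableAt ℂ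
        (fun z => (phi p q a α z π).1 * (v π).2 - (phi p q a α z π).2 * (v π).1) z₀ := by
      intro v hv
      have hvc : ContinuousOn v (Icc 0 π) := by
        simpa [uIcc_of_le Real.pi_pos.le] using (H.isSolution_iff.1 hv).continuousOn
      refine (hasDerivAt_of_eq_add_sub_mul (c := (v 0).1)
        (H.continuous_integral_phi_mul hvc).neg.continuousAt fun z => ?_).differentiableAt
      rw [H.lagrange (H.phi_spec z).1 hv π hmem, (H.phi_spec z).2]
      simp only [Pi.neg_apply]
      ring
    have hP := hwr _ (H.phi_spec z₀).1
    have hQ := hwr _ hu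
    constructor
    · have := (hQ.mul_const (phi p q a α z₀ π).1).sub (hP.mul_const (u π).1)
      refine this.congr_of_eventuallyEq (Eventually.of_forall fun z => ?_)
      simp only [Pi.sub_apply]
      linear_combination (-(phi p q a α z π).1) * hW
    · have := (hQ.mul_const (phi p q a α z₀ π).2).sub (hP.mul_const (u π).2)
      refine this.congr_of_eventuallyEq (Eventually.of_forall fun z => ?_)
      simp only [Pi.sub_apply]
      linear_combination (-(phi p q a α z π).2) * hW
  exact ⟨fun z => (key z).1, fun z => (key z).2⟩

theorem differentiable_charFun (h₁ h₂ : ℝ) : Differentiable ℂ (charFun p q a α h₁ h₂) := by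
  obtain ⟨h1, h2⟩ := H.differentiable_phi_pi
  exact ((differentiable_id.add_const _).mul h1).add (h2.const_mul _)

theorem intervalIntegrable_normSq_phi (z : ℂ) : IntervalIntegrable
    (fun t => rho a α t * (‖(phi p q a α z t).1‖ ^ 2 + ‖(phi p q a α z t).2‖ ^ 2))
    volume 0 π := by
  refine (intervalIntegrable_rho H.pos 0 π).mul_continuousOn ?_
  rw [uIcc_of_le Real.pi_pos.le]
  exact ((H.continuousOn_phi z).fst.norm.pow 2).add ((H.continuousOn_phi z).snd.norm.pow 2)

theorem integral_normSq_phi_pos (z : ℂ) :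
    0 < ∫ t in (0 : ℝ)..π,
      rho a α t * (‖(phi p q a α z t).1‖ ^ 2 + ‖(phi p q a α z t).2‖ ^ 2) := by
  refine intervalIntegral.intervalIntegral_pos_of_pos_on (H.intervalIntegrable_normSq_phi z)
    (fun t ht => mul_pos (rho_pos H.pos t) ?_) Real.pi_pos
  by_contra hle
  refine H.phi_ne_zero z (Ioo_subset_Icc_self ht) ?_
  have h1 := sq_nonneg ‖(phi p q a α z t).1‖
  have h2 := sq_nonneg ‖(phi p q a α z t).2‖
  have e1 : ‖(phi p q a α z t).1‖ ^ 2 = 0 := by linarith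
  have e2 : ‖(phi p q a α z t).2‖ ^ 2 = 0 := by linarith
  exact Prod.ext (by simpa using e1) (by simpa using e2)

theorem integral_phi_conj_mul_phi (z : ℂ) :
    ∫ t in (0 : ℝ)..π, (rho a α t : ℂ) *
      ((phi p q a α (starRingEnd ℂ z) t).1 * (phi p q a α z t).1 +
        (phi p q a α (starRingEnd ℂ z) t).2 * (phi p q a α z t).2) =
      ((∫ t in (0 : ℝ)..π,
        rho a α t * (‖(phi p q a α z t).1‖ ^ 2 + ‖(phi p q a α z t).2‖ ^ 2) : ℝ) : ℂ) := by
  rw [← intervalIntegral.integral_ofReal]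
  refine intervalIntegral.integral_congr fun t ht => ?_
  rw [uIcc_of_le Real.pi_pos.le] at ht
  simp only [H.phi_conj z t ht, Complex.conj_mul']
  push_cast
  ring

section BoundaryCondition

variable {h₁ h₂ : ℝ}

theorem isEigenfunction_phi {z : ℂ} (hz : charFun p q a α h₁ h₂ z = 0) :
    IsEigenfunction p q a α h₁ h₂ z (phi p q a α z) where
  solution := (H.phi_spec z).1
  left := by rw [(H.phi_spec z).2]
  right := hz
  nontrivial := ⟨0, ⟨le_rfl, Real.pi_pos.le⟩, H.phi_ne_zero z ⟨le_rfl, Real.pi_pos.le⟩⟩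

theorem charFun_eq_zero_of_isEigenvalue {z : ℂ} (hz : IsEigenvalue p q a α h₁ h₂ z) :
    charFun p q a α h₁ h₂ z = 0 := by
  obtain ⟨y, hy⟩ := hz
  have hsm := H.eq_smul_phi hy.solution hy.left
  obtain ⟨x, hx, hx0⟩ := hy.nontrivial
  have hc : -(y 0).2 ≠ 0 := fun h => hx0 (by rw [hsm x hx, h, zero_smul])
  have hr := hy.right
  rw [hsm π ⟨Real.pi_pos.le, le_rfl⟩] at hr
  refine (mul_eq_zero.1 (?_ : -(y 0).2 * charFun p q a α h₁ h₂ z = 0)).resolve_left hc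
  rw [← hr, charFun]
  simp only [Prod.smul_fst, Prod.smul_snd, smul_eq_mul]
  ring

theorem isEigenvalue_iff {z : ℂ} :
    IsEigenvalue p q a α h₁ h₂ z ↔ charFun p q a α h₁ h₂ z = 0 :=
  ⟨H.charFun_eq_zero_of_isEigenvalue, fun h => ⟨_, H.isEigenfunction_phi h⟩⟩

/-- The zeros of `Δ` are real, by Lagrange's identity for `φ(·, z)` and its conjugate. -/
theorem conj_eq_of_charFun_eq_zero (hh₂ : 0 < h₂) {z : ℂ}
    (hz : charFun p q a α h₁ h₂ z = 0) : starRingEnd ℂ z = z := by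
  have hmem : π ∈ Icc 0 π := ⟨Real.pi_pos.le, le_rfl⟩
  have hL := H.lagrange (H.phi_spec (starRingEnd ℂ z)).1 (H.phi_spec z).1 π hmem
  rw [H.integral_phi_conj_mul_phi, (H.phi_spec z).2, (H.phi_spec _).2, H.phi_conj z π hmem] at hL
  set N : ℝ := ∫ t in (0 : ℝ)..π,
    rho a α t * (‖(phi p q a α z t).1‖ ^ 2 + ‖(phi p q a α z t).2‖ ^ 2) with hN
  have hNpos : 0 < N := H.integral_normSq_phi_pos z
  have hz' := congrArg (starRingEnd ℂ) hz
  rw [charFun] at hz hz'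
  simp only [map_add, map_mul, Complex.conj_ofReal, map_zero] at hz'
  set u := (phi p q a α z π).1
  set v := (phi p q a α z π).2
  have key : (z - starRingEnd ℂ z) * ((h₂ * N + ‖u‖ ^ 2 : ℝ) : ℂ) = 0 := by
    push_cast
    rw [← Complex.conj_mul']
    linear_combination (-(h₂ : ℂ)) * hL + (starRingEnd ℂ u) * hz - u * hz'
  have hpos : 0 < h₂ * N + ‖u‖ ^ 2 := by positivity
  have := (mul_eq_zero.1 key).resolve_right (by exact_mod_cast hpos.ne')
  exact (sub_eq_zero.1 this).symm

/-- The zeros of `Δ` are simple: `φ₁(π, z) Δ'(z) = φ₁(π, z)² + h₂ ∫ ρ (φ₁² + φ₂²)` at a zero. -/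
theorem analyticOrderAt_charFun_eq_one (hh₂ : 0 < h₂) {z : ℂ}
    (hz : charFun p q a α h₁ h₂ z = 0) : analyticOrderAt (charFun p q a α h₁ h₂) z = 1 := by
  have hmem : π ∈ Icc 0 π := ⟨Real.pi_pos.le, le_rfl⟩
  have hd := H.differentiable_charFun h₁ h₂
  have hconj := H.conj_eq_of_charFun_eq_zero hh₂ hz
  refine (hd.analyticAt z).analyticOrderAt_eq_one_of_zero_deriv_ne_zero hz ?_
  set K : ℂ → ℂ := fun w => (phi p q a α z π).1 * (phi p q a α w π).1 +
    h₂ * ∫ t in (0 : ℝ)..π, (rho a α t : ℂ) * ((phi p q a α w t).1 * (phi p q a α z t).1 +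
      (phi p q a α w t).2 * (phi p q a α z t).2) with hK
  have hKc : Continuous K :=
    (continuous_const.mul (H.continuous_phi_apply hmem).fst).add
      (continuous_const.mul (H.continuous_integral_phi_mul (H.continuousOn_phi z)))
  have hder := hasDerivAt_of_eq_add_sub_mul (f := fun w => (phi p q a α z π).1 *
    charFun p q a α h₁ h₂ w) (c := 0) (hKc.continuousAt (x := z)) (fun w => by
      have hL := H.lagrange (H.phi_spec w).1 (H.phi_spec z).1 π hmem
      rw [(H.phi_spec z).2, (H.phi_spec w).2] at hL
      rw [charFun] at hz
      simp only [charFun, hK]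
      linear_combination (phi p q a α w π).1 * hz - (h₂ : ℂ) * hL)
  intro h0
  have h1 := ((hd z).hasDerivAt.const_mul (phi p q a α z π).1).unique hder
  rw [h0, mul_zero] at h1
  have h2 := H.integral_phi_conj_mul_phi z
  have h3 := H.phi_conj z π hmem
  rw [hconj] at h2 h3
  have h4 := congrArg Prod.fst h3
  simp only at h4
  have hval : K z = ((‖(phi p q a α z π).1‖ ^ 2 + h₂ * ∫ t in (0 : ℝ)..π,
      rho a α t * (‖(phi p q a α z t).1‖ ^ 2 + ‖(phi p q a α z t).2‖ ^ 2) : ℝ) : ℂ) := by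
    rw [hK]
    simp only [h2]
    push_cast
    rw [← Complex.conj_mul', ← h4]
  have hpos := H.integral_normSq_phi_pos z
  rw [hval] at h1
  have h5 : ‖(phi p q a α z π).1‖ ^ 2 + h₂ * ∫ t in (0 : ℝ)..π,
      rho a α t * (‖(phi p q a α z t).1‖ ^ 2 + ‖(phi p q a α z t).2‖ ^ 2) = 0 := by
    exact_mod_cast h1.symm
  nlinarith [sq_nonneg ‖(phi p q a α z π).1‖, mul_pos hh₂ hpos]

end BoundaryCondition

end Admissible

end DiracBVP

/-! ### The Prüfer phase for real parameters -/

namespace DiracBVP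

open Filter Topology

/-- A continuous function that increases to the right of every point is strictly increasing. -/
theorem strictMono_of_eventually_nhdsGT {f : ℝ → ℝ} (hf : Continuous f)
    (h : ∀ x, ∀ᶠ y in 𝓝[>] x, f x < f y) : StrictMono f := by
  have hmono : Monotone f := by
    intro x y hxy
    have hcl : IsClosed ({t | f x ≤ f t} ∩ Icc x y) :=
      (isClosed_le continuous_const hf).inter isClosed_Icc
    refine hcl.Icc_subset_of_forall_mem_nhdsWithin (show f x ≤ f x from le_rfl) (fun t ht => ?_)
      ⟨hxy, le_rfl⟩
    filter_upwards [h t] with s hs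
    exact (show f x ≤ f t from ht.1).trans hs.le
  intro x y hxy
  obtain ⟨c, hc, hcy⟩ := ((h x).and (Ioo_mem_nhdsGT hxy)).exists
  exact hc.trans_le (hmono hcy.2.le)

/-- The complex potential `q - i p`, by which `φ₁ - i φ₂` enters the equation for `φ₁ + i φ₂`. -/
noncomputable def potential (p q : ℝ → ℝ) (t : ℝ) : ℂ := (q t : ℂ) - Complex.I * (p t : ℂ)

/-- The complex logarithm of the solution relative to the free one: for real `l`,
`φ₁ + i φ₂ = -i exp (i l μ(x) + logRatio)`. Its real part is the logarithm of the amplitude and its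
imaginary part the correction to the phase `l μ(x)`. It is defined by integrating the
logarithmic derivative, so that no branch has to be chosen. -/
noncomputable def logRatio (p q : ℝ → ℝ) (a α l x : ℝ) : ℂ :=
  ∫ t in (0 : ℝ)..x, potential p q t *
    (((phi p q a α l t).1 - Complex.I * (phi p q a α l t).2) /
      ((phi p q a α l t).1 + Complex.I * (phi p q a α l t).2))

/-- The Prüfer phase of `φ(x, l)` for real `l`. -/
noncomputable def phase (p q : ℝ → ℝ) (a α l x : ℝ) : ℝ :=
  l * mu a α x + (logRatio p q a α l x).im

namespace Admissible

variable {p q : ℝ → ℝ} {a α : ℝ} (H : Admissible p q a α)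
include H

theorem memLp_potential : MemLp (potential p q) 2 (volume.restrict (Ioc 0 π)) :=
  H.memLp_q.ofReal.sub (H.memLp_p.ofReal.const_mul Complex.I)

theorem intervalIntegrable_potential : IntervalIntegrable (potential p q) volume 0 π := by
  rw [intervalIntegrable_iff_integrableOn_Ioc_of_le Real.pi_pos.le]
  exact H.memLp_potential.integrable (by norm_num)

/-- For a real parameter the solution `φ` is real. -/
theorem phi_ofReal (l : ℝ) {x : ℝ} (hx : x ∈ Icc 0 π) :
    phi p q a α l x = (((phi p q a α l x).1.re : ℂ), ((phi p q a α l x).2.re : ℂ)) := by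
  have h := H.phi_conj (l : ℂ) x hx
  rw [Complex.conj_ofReal] at h
  refine Prod.ext ?_ ?_
  · exact (Complex.conj_eq_iff_re.1 (congrArg Prod.fst h).symm).symm
  · exact (Complex.conj_eq_iff_re.1 (congrArg Prod.snd h).symm).symm

theorem phi_fst_add_ne_zero (l : ℝ) {x : ℝ} (hx : x ∈ Icc 0 π) :
    (phi p q a α l x).1 + Complex.I * (phi p q a α l x).2 ≠ 0 := by
  intro h0
  have hr := H.phi_ofReal l hx
  refine H.phi_ne_zero l hx ?_
  rw [hr] at h0 ⊢
  have h1 := congrArg Complex.re h0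
  have h2 := congrArg Complex.im h0
  simp at h1 h2
  simp [h1, h2]

theorem norm_phi_quotient (l : ℝ) {x : ℝ} (hx : x ∈ Icc 0 π) :
    ‖((phi p q a α l x).1 - Complex.I * (phi p q a α l x).2) /
      ((phi p q a α l x).1 + Complex.I * (phi p q a α l x).2)‖ = 1 := by
  have hne := H.phi_fst_add_ne_zero l hx
  have hr := H.phi_ofReal l hx
  have e : (phi p q a α l x).1 - Complex.I * (phi p q a α l x).2 =
      starRingEnd ℂ ((phi p q a α l x).1 + Complex.I * (phi p q a α l x).2) := by
    rw [hr]
    simp [sub_eq_add_neg]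
  rw [norm_div, e, RCLike.norm_conj, div_self (norm_ne_zero_iff.2 hne)]

theorem continuousOn_phi_quotient (l : ℝ) : ContinuousOn (fun x =>
    ((phi p q a α l x).1 - Complex.I * (phi p q a α l x).2) /
      ((phi p q a α l x).1 + Complex.I * (phi p q a α l x).2)) (Icc 0 π) := by
  have h := H.continuousOn_phi (l : ℂ)
  exact (h.fst.sub (continuousOn_const.mul h.snd)).div (h.fst.add (continuousOn_const.mul h.snd))
    fun x hx => H.phi_fst_add_ne_zero l hx

theorem isPrimitive_logRatio (l : ℝ) : IsPrimitive (logRatio p q a α l)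
    (fun t => potential p q t * (((phi p q a α l t).1 - Complex.I * (phi p q a α l t).2) /
      ((phi p q a α l t).1 + Complex.I * (phi p q a α l t).2))) 0 π := by
  have hi := H.intervalIntegrable_potential.mul_continuousOn
    (by simpa [uIcc_of_le Real.pi_pos.le] using H.continuousOn_phi_quotient l)
  have h := IsPrimitive.of_integral hi 0
  simp only [zero_add] at h
  exact h

theorem norm_logRatio_le (l : ℝ) {x : ℝ} (hx : x ∈ Icc 0 π) :
    ‖logRatio p q a α l x‖ ≤ ∫ t in (0 : ℝ)..π, ‖potential p q t‖ := by
  have hsub : uIcc 0 x ⊆ uIcc 0 π := uIcc_subset_uIcc_left (by rwa [uIcc_of_le Real.pi_pos.le])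
  refine (intervalIntegral.norm_integral_le_of_norm_le hx.1 (g := fun t => ‖potential p q t‖)
    (Eventually.of_forall fun t ht => ?_)
    (H.intervalIntegrable_potential.norm.mono_set hsub)).trans ?_
  · rw [norm_mul, H.norm_phi_quotient l ⟨ht.1.le, ht.2.trans hx.2⟩, mul_one]
  · exact intervalIntegral.integral_mono_interval le_rfl hx.1 hx.2
      (Eventually.of_forall fun _ => norm_nonneg _) H.intervalIntegrable_potential.norm

theorem continuous_logRatio_pi : Continuous fun l => logRatio p q a α l π := by
  have hpi := Real.pi_pos.le
  refine intervalIntegral.continuous_of_dominated_interval (bound := fun t => ‖potential p q t‖)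
    (fun l => (intervalIntegrable_iff.1 (H.isPrimitive_logRatio l).intervalIntegrable).1)
    (fun l => Eventually.of_forall fun t ht => ?_) H.intervalIntegrable_potential.norm
    (Eventually.of_forall fun t ht => ?_)
  · rw [uIoc_of_le hpi] at ht
    rw [norm_mul, H.norm_phi_quotient l (Ioc_subset_Icc_self ht), mul_one]
  · rw [uIoc_of_le hpi] at ht
    have h := (H.continuous_phi_apply (Ioc_subset_Icc_self ht)).comp Complex.continuous_ofReal
    exact continuous_const.mul ((h.fst.sub (continuous_const.mul h.snd)).div
      (h.fst.add (continuous_const.mul h.snd)) fun l =>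
        H.phi_fst_add_ne_zero l (Ioc_subset_Icc_self ht))

/-- The defining property of `logRatio`: the quotient of both sides has derivative zero. -/
theorem phi_fst_add_eq (l : ℝ) {x : ℝ} (hx : x ∈ Icc 0 π) :
    (phi p q a α l x).1 + Complex.I * (phi p q a α l x).2 =
      -Complex.I * Complex.exp (Complex.I * l * mu a α x + logRatio p q a α l x) := by
  have hφ := H.isPrimitive_phi (l : ℂ)
  have h1 := (hφ.clm_comp (ContinuousLinearMap.fst ℝ ℂ ℂ)).add
    ((hφ.clm_comp (ContinuousLinearMap.snd ℝ ℂ ℂ)).const_mul Complex.I)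
  have h2 := ((((isPrimitive_mu (a := a) H.pos 0 π).const_mul (Complex.I * l)).add
    (H.isPrimitive_logRatio l)).const_mul (-1)).cexp
  have hW := (h1.mul h2).eq_add_integral x (by rwa [uIcc_of_le Real.pi_pos.le])
  rw [intervalIntegral.integral_congr (g := fun _ => 0) fun t ht => ?_] at hW
  · simp only [ContinuousLinearMap.coe_fst', ContinuousLinearMap.coe_snd', (H.phi_spec _).2,
      mu_zero H.nonneg, intervalIntegral.integral_zero, add_zero, logRatio,
      intervalIntegral.integral_same] at hW
    rw [← logRatio] at hW
    have hE := Complex.exp_ne_zero (Complex.I * l * mu a α x + logRatio p q a α l x)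
    rw [neg_one_mul, Complex.exp_neg, ← div_eq_mul_inv, div_eq_iff hE] at hW
    rw [hW]
    simp
  · rw [uIcc_of_le hx.1] at ht
    have hw := div_mul_cancel₀ ((phi p q a α l t).1 - Complex.I * (phi p q a α l t).2)
      (H.phi_fst_add_ne_zero l ⟨ht.1, ht.2.trans hx.2⟩)
    simp only [ContinuousLinearMap.coe_fst', ContinuousLinearMap.coe_snd', coeff_apply]
    set e := Complex.exp (-1 * (Complex.I * l * mu a α t + logRatio p q a α l t))
    set w := ((phi p q a α l t).1 - Complex.I * (phi p q a α l t).2) /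
      ((phi p q a α l t).1 + Complex.I * (phi p q a α l t).2)
    simp only [potential]
    linear_combination (-e * ((q t : ℂ) - Complex.I * p t)) * hw -
      e * (p t + l * rho a α t) * (phi p q a α l t).2 * Complex.I_sq

/-- The solution in Prüfer form. -/
theorem phi_eq_phase (l : ℝ) {x : ℝ} (hx : x ∈ Icc 0 π) : phi p q a α l x =
    (((Real.exp (logRatio p q a α l x).re * Real.sin (phase p q a α l x) : ℝ) : ℂ),
      ((-(Real.exp (logRatio p q a α l x).re * Real.cos (phase p q a α l x)) : ℝ) : ℂ)) := by
  have h := H.phi_fst_add_eq l hx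
  have hr := H.phi_ofReal l hx
  have he : Complex.I * l * mu a α x + logRatio p q a α l x =
      ((logRatio p q a α l x).re : ℂ) + (phase p q a α l x : ℂ) * Complex.I := by
    conv_lhs => rw [← Complex.re_add_im (logRatio p q a α l x)]
    rw [phase]
    push_cast
    ring
  rw [he, Complex.exp_add_mul_I, ← Complex.ofReal_exp, ← Complex.ofReal_cos,
    ← Complex.ofReal_sin] at h
  have h1 := congrArg Complex.re h
  have h2 := congrArg Complex.im h
  rw [hr] at h1 h2 ⊢
  simp only [Complex.add_re, Complex.add_im, Complex.mul_re, Complex.mul_im, Complex.neg_re,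
    Complex.neg_im, Complex.I_re, Complex.I_im, Complex.ofReal_re, Complex.ofReal_im] at h1 h2
  refine Prod.ext ?_ ?_
  · simp only
    congr 1
    linear_combination h1
  · simp only
    congr 1
    linear_combination h2

/-- The integral equation of the complex phase correction. -/
theorem logRatio_eq (l : ℝ) {x : ℝ} (hx : x ∈ Icc 0 π) : logRatio p q a α l x =
    -∫ t in (0 : ℝ)..x, potential p q t * Complex.exp (-(2 * phase p q a α l t * Complex.I)) := by
  rw [← intervalIntegral.integral_neg]
  refine intervalIntegral.integral_congr fun t ht => ?_
  rw [uIcc_of_le hx.1] at ht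
  have ht' : t ∈ Icc 0 π := ⟨ht.1, ht.2.trans hx.2⟩
  have hne := H.phi_fst_add_ne_zero l ht'
  rw [neg_mul_eq_mul_neg]
  congr 1
  rw [div_eq_iff hne, H.phi_eq_phase l ht']
  have e1 : Complex.exp (-(2 * phase p q a α l t * Complex.I)) =
      (Complex.cos (phase p q a α l t) - Complex.sin (phase p q a α l t) * Complex.I) ^ 2 := by
    have e2 := Complex.exp_mul_I (-(phase p q a α l t : ℂ))
    rw [Complex.cos_neg, Complex.sin_neg, neg_mul (Complex.sin _), ← sub_eq_add_neg] at e2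
    rw [← e2, ← Complex.exp_nat_mul]
    congr 1
    push_cast
    ring
  have hcs := Complex.sin_sq_add_cos_sq (phase p q a α l t : ℂ)
  rw [e1]
  push_cast
  set s := Complex.sin (phase p q a α l t : ℂ)
  set c := Complex.cos (phase p q a α l t : ℂ)
  set A := Complex.exp ((logRatio p q a α l t).re : ℂ)
  linear_combination (-A * Complex.I * (c - s * Complex.I)) * hcs +
    A * (Complex.I * (c - s * Complex.I) * s ^ 2 + s * (c - s * Complex.I) ^ 2 + s) * Complex.I_sq

theorem continuous_phase_pi : Continuous fun l => phase p q a α l π :=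
  (continuous_id.mul continuous_const).add (Complex.continuous_im.comp H.continuous_logRatio_pi)

/-- The phase at `π` increases with the parameter. By Lagrange's identity, `sin` of the increment
has the sign of the increment of the parameter. -/
theorem strictMono_phase_pi : StrictMono fun l => phase p q a α l π := by
  have hmem : π ∈ Icc 0 π := ⟨Real.pi_pos.le, le_rfl⟩
  refine strictMono_of_eventually_nhdsGT H.continuous_phase_pi fun l₀ => ?_
  have hK := (Complex.continuous_re.comp
    (H.continuous_integral_phi_mul (H.continuousOn_phi (l₀ : ℂ)))).comp Complex.continuous_ofReal
  have hK0 := H.integral_phi_conj_mul_phi (l₀ : ℂ)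
  rw [Complex.conj_ofReal] at hK0
  have hpos := H.integral_normSq_phi_pos (l₀ : ℂ)
  have ev1 : ∀ᶠ l : ℝ in 𝓝 l₀, 0 < (∫ t in (0 : ℝ)..π, (rho a α t : ℂ) *
      ((phi p q a α l t).1 * (phi p q a α l₀ t).1 +
        (phi p q a α l t).2 * (phi p q a α l₀ t).2)).re := by
    refine (hK.tendsto l₀).eventually (lt_mem_nhds ?_)
    simp only [Function.comp_apply]
    rw [hK0, Complex.ofReal_re]
    exact hpos
  have ev2 : ∀ᶠ l : ℝ in 𝓝 l₀, phase p q a α l₀ π - π < phase p q a α l π :=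
    (H.continuous_phase_pi.tendsto l₀).eventually (lt_mem_nhds (by linarith [Real.pi_pos]))
  filter_upwards [nhdsWithin_le_nhds ev1, nhdsWithin_le_nhds ev2, self_mem_nhdsWithin]
    with l h1 h2 h3
  have hL := H.lagrange (H.phi_spec (l : ℂ)).1 (H.phi_spec (l₀ : ℂ)).1 π hmem
  rw [(H.phi_spec _).2, (H.phi_spec _).2, H.phi_eq_phase l hmem, H.phi_eq_phase l₀ hmem] at hL
  have hL' := congrArg Complex.re hL
  rw [← Complex.ofReal_sub l₀ l] at hL'
  simp only [zero_mul, mul_zero, sub_zero, zero_add, Complex.re_ofReal_mul,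
    ← Complex.ofReal_mul, ← Complex.ofReal_sub, Complex.ofReal_re] at hL'
  set A := Real.exp (logRatio p q a α l π).re
  set A₀ := Real.exp (logRatio p q a α l₀ π).re
  have hA : 0 < A * A₀ := by positivity
  by_contra hle
  rw [not_lt] at hle
  have hsin : 0 ≤ Real.sin (phase p q a α l₀ π - phase p q a α l π) :=
    Real.sin_nonneg_of_nonneg_of_le_pi (by linarith) (by linarith)
  rw [Real.sin_sub] at hsin
  have hneg : (l - l₀) * (∫ t in (0 : ℝ)..π, (rho a α t : ℂ) *
      ((phi p q a α l t).1 * (phi p q a α l₀ t).1 +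
        (phi p q a α l t).2 * (phi p q a α l₀ t).2)).re > 0 :=
    mul_pos (sub_pos.2 h3) h1
  nlinarith [mul_nonneg hA.le hsin]

/-- The distance of the phase from the free phase is bounded independently of the parameter. -/
theorem abs_phase_sub_le (l : ℝ) {x : ℝ} (hx : x ∈ Icc 0 π) :
    |phase p q a α l x - l * mu a α x| ≤ ∫ t in (0 : ℝ)..π, ‖potential p q t‖ := by
  rw [phase, add_sub_cancel_left]
  exact (Complex.abs_im_le_norm _).trans (H.norm_logRatio_le l hx)

section Enumeration

variable {h₁ h₂ : ℝ} (hh₂ : 0 < h₂)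
include hh₂

/-- With `β = arctan ((l + h₁) / h₂)`, the value `Δ(l)` is a nonzero multiple of
`cos (phase + β)`. -/
theorem charFun_ofReal_eq_zero_iff (l : ℝ) : charFun p q a α h₁ h₂ l = 0 ↔
    ∃ k : ℤ, phase p q a α l π + Real.arctan ((l + h₁) / h₂) = π / 2 + k * π := by
  have hmem : π ∈ Icc 0 π := ⟨Real.pi_pos.le, le_rfl⟩
  set s := phase p q a α l π with hs
  set β := Real.arctan ((l + h₁) / h₂) with hβ
  have hcβ : 0 < Real.cos β := Real.cos_arctan_pos _
  have htan : Real.sin β * h₂ = (l + h₁) * Real.cos β := by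
    have h1 := Real.tan_arctan ((l + h₁) / h₂)
    rw [← hβ, Real.tan_eq_sin_div_cos, div_eq_div_iff hcβ.ne' hh₂.ne'] at h1
    exact h1
  have hval : (Real.cos β : ℂ) * charFun p q a α h₁ h₂ l =
      ((-(h₂ * Real.exp (logRatio p q a α l π).re) * Real.cos (s + β) : ℝ) : ℂ) := by
    rw [charFun, H.phi_eq_phase l hmem, Real.cos_add, ← hs]
    have : Real.cos β * ((l + h₁) * (Real.exp (logRatio p q a α l π).re * Real.sin s) +
        h₂ * -(Real.exp (logRatio p q a α l π).re * Real.cos s)) =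
        -(h₂ * Real.exp (logRatio p q a α l π).re) *
          (Real.cos s * Real.cos β - Real.sin s * Real.sin β) := by
      linear_combination (-Real.exp (logRatio p q a α l π).re * Real.sin s) * htan
    simp only
    exact_mod_cast this
  have hE := Real.exp_pos (logRatio p q a α l π).re
  have h1 : charFun p q a α h₁ h₂ l = 0 ↔ Real.cos (s + β) = 0 := by
    constructor
    · intro h
      rw [h, mul_zero] at hval
      have h2 : -(h₂ * Real.exp (logRatio p q a α l π).re) * Real.cos (s + β) = 0 := by
        exact_mod_cast hval.symm
      exact (mul_eq_zero.1 h2).resolve_left (neg_ne_zero.2 (by positivity))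
    · intro h
      rw [h, mul_zero, Complex.ofReal_zero] at hval
      exact (mul_eq_zero.1 hval).resolve_left (by exact_mod_cast hcβ.ne')
  rw [h1, Real.cos_eq_zero_iff]
  exact exists_congr fun k => by
    rw [show (2 * (k : ℝ) + 1) * π / 2 = π / 2 + k * π by ring]

/-- The zeros of `Δ` are the points at which a strictly increasing surjective function takes the
values `π / 2 + k π`; thus they are enumerated by `k ∈ ℤ`. -/
theorem exists_enumeration : ∃ ζ : ℤ → ℝ, Function.Injective ζ ∧
    (∀ k, phase p q a α (ζ k) π + Real.arctan ((ζ k + h₁) / h₂) = π / 2 + k * π) ∧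
    ∀ z : ℂ, charFun p q a α h₁ h₂ z = 0 ↔ ∃ k, (ζ k : ℂ) = z := by
  have hmem : π ∈ Icc 0 π := ⟨Real.pi_pos.le, le_rfl⟩
  have hL := mu_pi_pos H.nonneg H.pos
  set f : ℝ → ℝ := fun l => phase p q a α l π + Real.arctan ((l + h₁) / h₂) with hf
  have hfc : Continuous f :=
    H.continuous_phase_pi.add (Real.continuous_arctan.comp (by fun_prop))
  have hfm : StrictMono f := by
    refine H.strictMono_phase_pi.add_monotone fun x y hxy => ?_
    exact Real.arctan_mono (by gcongr)
  set R : ℝ := ∫ t in (0 : ℝ)..π, ‖potential p q t‖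
  have hb : ∀ l, |f l - l * mu a α π| ≤ R + π := by
    intro l
    have h1 := H.abs_phase_sub_le l hmem
    have h2 : |Real.arctan ((l + h₁) / h₂)| ≤ π := by
      rw [abs_le]
      constructor <;> linarith [Real.arctan_lt_pi_div_two ((l + h₁) / h₂),
        Real.neg_pi_div_two_lt_arctan ((l + h₁) / h₂), Real.pi_pos]
    rw [show f l - l * mu a α π = (phase p q a α l π - l * mu a α π) +
      Real.arctan ((l + h₁) / h₂) by rw [hf]; ring]
    exact (abs_add_le _ _).trans (add_le_add h1 h2)
  have hsurj : Function.Surjective f := by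
    refine hfc.surjective ?_ ?_
    · refine tendsto_atTop_mono (fun l => ?_)
        (tendsto_atTop_add_const_right _ (-(R + π)) (tendsto_id.atTop_mul_const hL))
      simp only [id]
      linarith [(abs_le.1 (hb l)).1]
    · refine tendsto_atBot_mono (fun l => ?_)
        (tendsto_atBot_add_const_right _ (R + π) (tendsto_id.atBot_mul_const hL))
      simp only [id]
      linarith [(abs_le.1 (hb l)).2]
  choose ζ hζ using fun k : ℤ => hsurj (π / 2 + k * π)
  refine ⟨ζ, fun k m hkm => ?_, hζ, fun z => ⟨fun hz => ?_, ?_⟩⟩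
  · have h := (hζ k).symm.trans ((congrArg f hkm).trans (hζ m))
    have h' : (k : ℝ) = m := mul_right_cancel₀ Real.pi_pos.ne' (add_left_cancel h)
    exact_mod_cast h'
  · have hre : (z.re : ℂ) = z := Complex.conj_eq_iff_re.1 (H.conj_eq_of_charFun_eq_zero hh₂ hz)
    rw [← hre] at hz
    obtain ⟨k, hk⟩ := (H.charFun_ofReal_eq_zero_iff hh₂ z.re).1 hz
    refine ⟨k, ?_⟩
    rw [← hre]
    exact congrArg _ (hfm.injective ((hζ k).trans hk.symm))
  · rintro ⟨k, rfl⟩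
    exact (H.charFun_ofReal_eq_zero_iff hh₂ _).2 ⟨k, hζ k⟩

end Enumeration

end Admissible

end DiracBVP

/-! ### Bessel's inequality along perturbed frequencies -/

namespace DiracBVP

open Filter Topology

/-- Bessel's inequality for exponentials of period `T` on an interval of length at most `T`. -/
theorem sum_sq_norm_integral_exp_le {g : ℝ → ℂ} {c d T : ℝ} (hcd : c ≤ d) (hT : 0 < T)
    (hdT : d - c ≤ T) (hg : MemLp g 2 (volume.restrict (Ioc c d))) (S : Finset ℤ) :
    ∑ n ∈ S, ‖∫ t in c..d, g t * Complex.exp (-(2 * (n * π / T * t : ℝ) * Complex.I))‖ ^ 2 ≤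
      T * ∫ t in c..d, ‖g t‖ ^ 2 := by
  have hlt : c < c + T := by linarith
  have hsub : Ioc c d ⊆ Ioc c (c + T) := Ioc_subset_Ioc_right (by linarith)
  have hg' : MemLp ((Ioc c d).indicator g) 2 (volume.restrict (Ioc c (c + T))) := by
    rw [memLp_indicator_iff_restrict measurableSet_Ioc, Measure.restrict_restrict measurableSet_Ioc,
      inter_eq_left.2 hsub]
    exact hg
  have hind : ∀ {F : Type} [NormedAddCommGroup F] [NormedSpace ℝ F] (f : ℝ → F),
      ∫ t in c..(c + T), (Ioc c d).indicator f t = ∫ t in c..d, f t := by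
    intro F _ _ f
    rw [intervalIntegral.integral_of_le hlt.le, intervalIntegral.integral_of_le hcd,
      setIntegral_indicator measurableSet_Ioc, inter_eq_right.2 hsub]
  have hP := hasSum_sq_fourierCoeffOn hlt hg'
  have hle := sum_le_hasSum S (fun _ _ => sq_nonneg _) hP
  have hnorm : ∫ t in c..(c + T), ‖(Ioc c d).indicator g t‖ ^ 2 = ∫ t in c..d, ‖g t‖ ^ 2 := by
    rw [← hind]
    refine intervalIntegral.integral_congr fun t _ => ?_
    by_cases ht : t ∈ Ioc c d <;> simp [ht]
  rw [hnorm, add_sub_cancel_left, smul_eq_mul] at hle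
  have hcoef : ∀ n : ℤ, ‖∫ t in c..d,
      g t * Complex.exp (-(2 * (n * π / T * t : ℝ) * Complex.I))‖ ^ 2 =
      T ^ 2 * ‖fourierCoeffOn hlt ((Ioc c d).indicator g) n‖ ^ 2 := by
    intro n
    rw [fourierCoeffOn_eq_integral, norm_smul, mul_pow, Real.norm_eq_abs, sq_abs, ← mul_assoc,
      add_sub_cancel_left, one_div, ← mul_pow, mul_inv_cancel₀ hT.ne', one_pow, one_mul, ← hind]
    congr 2
    refine intervalIntegral.integral_congr fun t _ => ?_
    by_cases ht : t ∈ Ioc c d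
    · simp only [ht, indicator_of_mem, smul_eq_mul, fourier_coe_apply]
      rw [mul_comm]
      congr 2
      push_cast
      ring
    · simp [ht]
  simp only [hcoef, ← Finset.mul_sum]
  calc T ^ 2 * ∑ n ∈ S, ‖fourierCoeffOn hlt ((Ioc c d).indicator g) n‖ ^ 2
      ≤ T ^ 2 * (T⁻¹ * ∫ t in c..d, ‖g t‖ ^ 2) := by gcongr
    _ = _ := by field_simp

/-- The oscillating factor `exp (-2 i l μ(t))`. -/
noncomputable def wave (a α l t : ℝ) : ℂ := Complex.exp (-(2 * (l * mu a α t : ℝ) * Complex.I))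

section Wave

variable {a α : ℝ}

theorem norm_wave (l t : ℝ) : ‖wave a α l t‖ = 1 := by
  rw [wave, show -(2 * ((l * mu a α t : ℝ) : ℂ) * Complex.I) =
    ((-(2 * (l * mu a α t)) : ℝ) : ℂ) * Complex.I by push_cast; ring]
  exact Complex.norm_exp_ofReal_mul_I _

theorem wave_add (l ε t : ℝ) : wave a α (l + ε) t = wave a α l t * wave a α ε t := by
  rw [wave, wave, wave, ← Complex.exp_add]
  congr 1
  push_cast
  ring

theorem continuous_wave (l : ℝ) : Continuous (wave a α l) := by
  have := continuous_mu (a := a) (α := α)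
  unfold wave
  fun_prop

theorem isPrimitive_wave (hα : 0 < α) (l c d : ℝ) : IsPrimitive (wave a α l)
    (fun t => wave a α l t * (-(2 * l * Complex.I) * rho a α t)) c d := by
  have h := ((isPrimitive_mu (a := a) hα c d).const_mul (-(2 * l * Complex.I))).cexp
  have e : ∀ t, wave a α l t = Complex.exp (-(2 * l * Complex.I) * mu a α t) := by
    intro t
    rw [wave]
    congr 1
    push_cast
    ring
  simpa only [← e] using h

theorem sq_integral_le {v : ℝ → ℝ} {b x : ℝ} (hx : x ∈ Icc 0 b) (hv : ContinuousOn v (Icc 0 b)) :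
    (∫ t in (0 : ℝ)..x, v t) ^ 2 ≤ b * ∫ t in (0 : ℝ)..x, v t ^ 2 := by
  have h := sq_intervalIntegral_mul_le (f := fun _ => (1 : ℝ)) (memLp_const 1) hx
    (memLp_two_of_continuousOn hv hx)
  simpa using h

end Wave

namespace Admissible

variable {p q : ℝ → ℝ} {a α : ℝ} (H : Admissible p q a α)
include H

theorem mu_pi_eq : mu a α π = α * (π - a) + a := by
  rw [mu_eq_max_min, min_eq_right H.le_pi, max_eq_left (by linarith [H.le_pi])]
  ring

/-- Bessel's inequality for the exponentials in `μ`, uniformly in the end point. The integral is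
split at `a`, so that `μ` is affine on each of the two intervals. -/
theorem sum_sq_norm_integral_wave_le {g : ℝ → ℂ} (hg : MemLp g 2 (volume.restrict (Ioc 0 π)))
    {x : ℝ} (hx : x ∈ Icc 0 π) (S : Finset ℤ) :
    ∑ n ∈ S, ‖∫ t in (0 : ℝ)..x, g t * wave a α (n * π / mu a α π) t‖ ^ 2 ≤
      2 * (mu a α π + mu a α π / α) * ∫ t in (0 : ℝ)..π, ‖g t‖ ^ 2 := by
  have ha := H.nonneg
  have hα := H.pos
  set L := mu a α π with hLdef
  have hL : 0 < L := mu_pi_pos ha hα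
  have hLeq : L = α * (π - a) + a := H.mu_pi_eq
  set m := min x a with hm
  have hm0 : 0 ≤ m := le_min hx.1 ha
  have hmx : m ≤ x := min_le_left _ _
  have hma : m ≤ a := min_le_right _ _
  have hxL : x - m ≤ L / α := by
    rw [le_div_iff₀ hα, hLeq]
    rcases le_total x a with h | h
    · rw [hm, min_eq_left h]
      nlinarith [H.le_pi]
    · rw [hm, min_eq_right h]
      nlinarith [hx.2]
  have hgsub : ∀ {c d : ℝ}, 0 ≤ c → d ≤ π → MemLp g 2 (volume.restrict (Ioc c d)) :=
    fun hc hd => hg.mono_measure (Measure.restrict_mono_set _ (Ioc_subset_Ioc hc hd))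
  have hgi : ∀ {c d : ℝ}, 0 ≤ c → c ≤ d → d ≤ π → ∀ l : ℝ,
      IntervalIntegrable (fun t => g t * wave a α l t) volume c d := by
    intro c d hc hcd hd l
    refine IntervalIntegrable.mul_continuousOn ?_ (continuous_wave l).continuousOn
    rw [intervalIntegrable_iff_integrableOn_Ioc_of_le hcd]
    exact (hgsub hc hd).integrable (by norm_num)
  have hnsq : IntervalIntegrable (fun t => ‖g t‖ ^ 2) volume 0 π := by
    rw [intervalIntegrable_iff_integrableOn_Ioc_of_le Real.pi_pos.le]
    exact hg.norm.integrable_sq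
  have hnle : ∀ {c d : ℝ}, 0 ≤ c → c ≤ d → d ≤ π →
      ∫ t in c..d, ‖g t‖ ^ 2 ≤ ∫ t in (0 : ℝ)..π, ‖g t‖ ^ 2 := fun hc hcd hd =>
    intervalIntegral.integral_mono_interval hc hcd hd
      (Eventually.of_forall fun _ => sq_nonneg _) hnsq
  have h1 := sum_sq_norm_integral_exp_le hm0 hL (by nlinarith [H.le_pi] : m - 0 ≤ L)
    (hgsub le_rfl (hmx.trans hx.2)) S
  have h2 := sum_sq_norm_integral_exp_le hmx (by positivity) hxL (hgsub hm0 hx.2) S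
  have e1 : ∀ n : ℤ, ∫ t in (0 : ℝ)..m, g t * wave a α (n * π / L) t =
      ∫ t in (0 : ℝ)..m, g t * Complex.exp (-(2 * (n * π / L * t : ℝ) * Complex.I)) := by
    intro n
    refine intervalIntegral.integral_congr fun t ht => ?_
    rw [uIcc_of_le hm0] at ht
    simp only [wave, mu, if_pos (ht.2.trans hma)]
  have e2 : ∀ n : ℤ, ‖∫ t in m..x, g t * wave a α (n * π / L) t‖ =
      ‖∫ t in m..x, g t * Complex.exp (-(2 * (n * π / (L / α) * t : ℝ) * Complex.I))‖ := by
    intro n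
    have hc : ‖Complex.exp (((-(2 * (n * π / L * (a - α * a))) : ℝ) : ℂ) * Complex.I)‖ = 1 :=
      Complex.norm_exp_ofReal_mul_I _
    rw [← one_mul ‖∫ t in m..x, g t * Complex.exp _‖, ← hc, ← norm_mul,
      ← intervalIntegral.integral_const_mul]
    congr 1
    refine intervalIntegral.integral_congr_ae (Eventually.of_forall fun t ht => ?_)
    rw [uIoc_of_le hmx] at ht
    have hta : ¬ t ≤ a := fun h => absurd ht.1 (not_lt.2 (le_min ht.2 h))
    rw [wave, mu, if_neg hta, mul_left_comm, ← Complex.exp_add]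
    congr 2
    push_cast
    field_simp
    ring
  have hsplit : ∀ n : ℤ, ‖∫ t in (0 : ℝ)..x, g t * wave a α (n * π / L) t‖ ^ 2 ≤
      2 * ‖∫ t in (0 : ℝ)..m, g t * Complex.exp (-(2 * (n * π / L * t : ℝ) * Complex.I))‖ ^ 2 +
      2 * ‖∫ t in m..x,
        g t * Complex.exp (-(2 * (n * π / (L / α) * t : ℝ) * Complex.I))‖ ^ 2 := by
    intro n
    rw [← intervalIntegral.integral_add_adjacent_intervals
      (hgi le_rfl hm0 (hmx.trans hx.2) _) (hgi hm0 hmx hx.2 _), ← e1, ← e2]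
    have h := norm_add_le (∫ t in (0 : ℝ)..m, g t * wave a α (n * π / L) t)
      (∫ t in m..x, g t * wave a α (n * π / L) t)
    have h0 := pow_le_pow_left₀ (norm_nonneg _) h 2
    nlinarith [sq_nonneg (‖∫ t in (0 : ℝ)..m, g t * wave a α (n * π / L) t‖ -
      ‖∫ t in m..x, g t * wave a α (n * π / L) t‖)]
  refine (Finset.sum_le_sum fun n _ => hsplit n).trans ?_
  rw [Finset.sum_add_distrib, ← Finset.mul_sum, ← Finset.mul_sum]
  have k1 := mul_le_mul_of_nonneg_left (hnle le_rfl hm0 (hmx.trans hx.2)) hL.le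
  have k2 := mul_le_mul_of_nonneg_left (hnle hm0 hmx hx.2) (div_pos hL hα).le
  linarith

/-- Bessel's inequality for frequencies at bounded distance from `n π / μ(π)`, uniformly in the
end point. Integration by parts moves the derivative onto the slowly varying factor
`exp (-2 i ε μ)` and leaves the integrals with the unperturbed frequencies. -/
theorem exists_sum_sq_norm_integral_wave_le {g : ℝ → ℂ}
    (hg : MemLp g 2 (volume.restrict (Ioc 0 π))) (M : ℝ) :
    ∃ C : ℝ, 0 ≤ C ∧ ∀ ε : ℤ → ℝ, (∀ n, |ε n| ≤ M) → ∀ x ∈ Icc 0 π, ∀ S : Finset ℤ,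
      ∑ n ∈ S, ‖∫ t in (0 : ℝ)..x, g t * wave a α (n * π / mu a α π + ε n) t‖ ^ 2 ≤ C := by
  have hpi := Real.pi_pos.le
  have hα := H.pos
  set L := mu a α π
  have hL : 0 < L := mu_pi_pos H.nonneg hα
  set B : ℝ := 2 * (L + L / α) * ∫ t in (0 : ℝ)..π, ‖g t‖ ^ 2 with hB
  have hB0 : 0 ≤ B := mul_nonneg (by positivity)
    (intervalIntegral.integral_nonneg hpi fun _ _ => sq_nonneg _)
  set D : ℝ := 2 * M * (1 + α) with hD
  refine ⟨2 * B + 2 * (D ^ 2 * (π * (π * B))), by positivity, fun ε hε x hx S => ?_⟩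
  set h : ℤ → ℝ → ℂ := fun n y => ∫ t in (0 : ℝ)..y, g t * wave a α (n * π / L) t with hh
  have hgi : ∀ l : ℝ, IntervalIntegrable (fun t => g t * wave a α l t) volume 0 π := by
    intro l
    refine IntervalIntegrable.mul_continuousOn ?_ (continuous_wave l).continuousOn
    rw [intervalIntegrable_iff_integrableOn_Ioc_of_le hpi]
    exact hg.integrable (by norm_num)
  have hprim : ∀ n, IsPrimitive (h n) (fun t => g t * wave a α (n * π / L) t) 0 π := by
    intro n
    have := IsPrimitive.of_integral (hgi (n * π / L)) 0
    simp only [zero_add] at this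
    exact this
  have hc : ∀ n, ContinuousOn (h n) (Icc 0 π) := fun n => by
    simpa [uIcc_of_le hpi] using (hprim n).continuousOn
  have hsub : uIcc 0 x ⊆ uIcc 0 π := uIcc_subset_uIcc_left (by rwa [uIcc_of_le hpi])
  have hterm : ∀ n, ‖∫ t in (0 : ℝ)..x, g t * wave a α (n * π / L + ε n) t‖ ^ 2 ≤
      2 * ‖h n x‖ ^ 2 + 2 * (D ^ 2 * (π * ∫ t in (0 : ℝ)..x, ‖h n t‖ ^ 2)) := by
    intro n
    have hM : 0 ≤ M := (abs_nonneg _).trans (hε n)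
    have hmul := ((hprim n).mul (isPrimitive_wave (a := a) hα (ε n) 0 π)).mono hsub
    have hFTC := hmul.eq_add_integral x right_mem_uIcc
    have hi2 : IntervalIntegrable (fun t => h n t * (wave a α (ε n) t *
        (-(2 * ε n * Complex.I) * rho a α t))) volume 0 x :=
      (((isPrimitive_wave (a := a) hα (ε n) 0 π).intervalIntegrable.continuousOn_mul
        (by simpa [uIcc_of_le hpi] using hc n))).mono_set hsub
    rw [intervalIntegral.integral_add (by
      simpa only [mul_assoc, ← wave_add] using (hgi (n * π / L + ε n)).mono_set hsub) hi2] at hFTC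
    simp only [mul_assoc (g _), ← wave_add] at hFTC
    have h0 : h n 0 = 0 := by simp [hh]
    rw [h0, zero_mul, zero_add] at hFTC
    have hrem : ‖∫ t in (0 : ℝ)..x, h n t * (wave a α (ε n) t *
        (-(2 * ε n * Complex.I) * rho a α t))‖ ≤ D * ∫ t in (0 : ℝ)..x, ‖h n t‖ := by
      rw [← intervalIntegral.integral_const_mul]
      refine intervalIntegral.norm_integral_le_of_norm_le hx.1
        (Eventually.of_forall fun t ht => ?_) ?_
      · rw [norm_mul, norm_mul, norm_wave, one_mul, norm_mul, norm_neg, norm_mul, norm_mul,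
          Complex.norm_I, mul_one, Complex.norm_real, Real.norm_eq_abs, mul_comm]
        have h2 : ‖(2 : ℂ)‖ = 2 := by simp
        rw [h2, hD]
        have := norm_rho_le (a := a) hα t
        have := hε n
        gcongr
      · refine (ContinuousOn.intervalIntegrable ?_).const_mul _
        rw [uIcc_of_le hx.1]
        exact ((hc n).mono (Icc_subset_Icc_right hx.2)).norm
    have hcs := sq_integral_le hx (hc n).norm
    have e : ∫ t in (0 : ℝ)..x, g t * wave a α (n * π / L + ε n) t =
        h n x * wave a α (ε n) x - ∫ t in (0 : ℝ)..x, h n t * (wave a α (ε n) t *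
          (-(2 * ε n * Complex.I) * rho a α t)) := by
      rw [hFTC]; ring
    rw [e]
    have hn := (norm_sub_le (h n x * wave a α (ε n) x) (∫ t in (0 : ℝ)..x, h n t *
      (wave a α (ε n) t * (-(2 * ε n * Complex.I) * rho a α t)))).trans (add_le_add le_rfl hrem)
    rw [norm_mul, norm_wave, mul_one] at hn
    have h0 := pow_le_pow_left₀ (norm_nonneg _) hn 2
    have hD2 : D ^ 2 * (∫ t in (0 : ℝ)..x, ‖h n t‖) ^ 2 ≤
        D ^ 2 * (π * ∫ t in (0 : ℝ)..x, ‖h n t‖ ^ 2) := by gcongr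
    nlinarith [sq_nonneg (‖h n x‖ - D * ∫ t in (0 : ℝ)..x, ‖h n t‖)]
  refine (Finset.sum_le_sum fun n _ => hterm n).trans ?_
  rw [Finset.sum_add_distrib, ← Finset.mul_sum, ← Finset.mul_sum, ← Finset.mul_sum,
    ← Finset.mul_sum]
  have hcx : ∀ n, ContinuousOn (fun t => ‖h n t‖ ^ 2) (uIcc 0 x) := fun n => by
    rw [uIcc_of_le hx.1]
    exact ((hc n).mono (Icc_subset_Icc_right hx.2)).norm.pow 2
  have hint : ∑ n ∈ S, ∫ t in (0 : ℝ)..x, ‖h n t‖ ^ 2 ≤ π * B := by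
    rw [← intervalIntegral.integral_finsetSum fun n _ => (hcx n).intervalIntegrable]
    have h1 := intervalIntegral.integral_mono_on hx.1
      ((continuousOn_finsetSum S fun n _ => hcx n).intervalIntegrable)
      (intervalIntegrable_const (μ := volume) (c := B)) (fun t ht =>
        H.sum_sq_norm_integral_wave_le hg ⟨ht.1, ht.2.trans hx.2⟩ S)
    rw [intervalIntegral.integral_const, sub_zero, smul_eq_mul] at h1
    exact h1.trans (mul_le_mul_of_nonneg_right hx.2 hB0)
  have hfirst := H.sum_sq_norm_integral_wave_le hg hx S
  gcongr

end Admissible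

end DiracBVP

/-! ### Square summability of the corrections along a perturbed list of frequencies -/

namespace DiracBVP

open Filter Topology

theorem sum_option_le {f : Option ℤ → ℝ} (hf : ∀ i, 0 ≤ f i) {A B : ℝ} (hA : f none ≤ A)
    (hB : ∀ S : Finset ℤ, ∑ n ∈ S, f (some n) ≤ B) (S : Finset (Option ℤ)) :
    ∑ i ∈ S, f i ≤ A + B := by
  classical
  have hsub : S ⊆ Finset.insertNone (Finset.eraseNone S) := by
    rw [Finset.insertNone_eraseNone]
    exact Finset.subset_insert _ _
  refine (Finset.sum_le_sum_of_subset_of_nonneg hsub fun i _ _ => hf i).trans ?_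
  rw [Finset.sum_insertNone]
  exact add_le_add hA (hB _)

namespace Admissible

variable {p q : ℝ → ℝ} {a α : ℝ} (H : Admissible p q a α)
include H

/-- Bessel's inequality for a list of frequencies that stays at bounded distance from the zeros of
`z sin (z μ(π))`. -/
theorem exists_sum_option_sq_norm_integral_wave_le {g : ℝ → ℂ}
    (hg : MemLp g 2 (volume.restrict (Ioc 0 π))) (M : ℝ) :
    ∃ C : ℝ, 0 ≤ C ∧ ∀ l : Option ℤ → ℝ, (∀ i, |l i - lamZero a α i| ≤ M) →
      ∀ x ∈ Icc 0 π, ∀ S : Finset (Option ℤ),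
        ∑ i ∈ S, ‖∫ t in (0 : ℝ)..x, g t * wave a α (l i) t‖ ^ 2 ≤ C := by
  obtain ⟨C, hC0, hC⟩ := H.exists_sum_sq_norm_integral_wave_le hg M
  refine ⟨C + C, by positivity, fun l hl x hx S => ?_⟩
  refine sum_option_le (f := fun i => ‖∫ t in (0 : ℝ)..x, g t * wave a α (l i) t‖ ^ 2)
    (fun _ => sq_nonneg _) ?_ (fun T => ?_) S
  · -- the additional index is a perturbation of the frequency with index `0`
    have h := hC (fun _ => l none) (fun _ => by simpa [lamZero] using hl none) x hx {0}
    simpa using h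
  · have h := hC (fun n => l (some n) - lamZero a α (some n)) (fun n => hl (some n)) x hx T
    simpa only [lamZero, add_sub_cancel] using h

/-- The integral equation for the phase correction: replacing its exponent by the free one costs a
factor `exp (-2 i Im Λ) - 1 = O(|Λ|)`, which is left to Grönwall's inequality. -/
theorem norm_logRatio_le_add_integral (l : ℝ) {x : ℝ} (hx : x ∈ Icc 0 π) :
    ‖logRatio p q a α l x‖ ≤ ‖∫ t in (0 : ℝ)..x, potential p q t * wave a α l t‖ +
      ∫ t in (0 : ℝ)..x, 2 * ‖potential p q t‖ * ‖logRatio p q a α l t‖ := by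
  have hsub : uIcc 0 x ⊆ uIcc 0 π := uIcc_subset_uIcc_left (by rwa [uIcc_of_le Real.pi_pos.le])
  have hΛc := (H.isPrimitive_logRatio l).continuousOn
  have hsplit : ∀ t, Complex.exp (-(2 * phase p q a α l t * Complex.I)) =
      wave a α l t * Complex.exp (Complex.I * ((-(2 * (logRatio p q a α l t).im) : ℝ) : ℂ)) := by
    intro t
    rw [wave, ← Complex.exp_add, phase]
    congr 1
    push_cast
    ring
  have hi1 : IntervalIntegrable (fun t => potential p q t * wave a α l t) volume 0 x :=
    (H.intervalIntegrable_potential.mul_continuousOn (continuous_wave l).continuousOn).mono_set hsub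
  have hcE : ContinuousOn (fun t => Complex.exp
      (Complex.I * ((-(2 * (logRatio p q a α l t).im) : ℝ) : ℂ)) - 1) (uIcc 0 π) := by
    have him := Complex.continuous_im.comp_continuousOn hΛc
    exact ((continuousOn_const.mul (Complex.continuous_ofReal.comp_continuousOn
      (continuousOn_const.mul him).neg)).cexp).sub continuousOn_const
  have hi2 : IntervalIntegrable (fun t => potential p q t * wave a α l t *
      (Complex.exp (Complex.I * ((-(2 * (logRatio p q a α l t).im) : ℝ) : ℂ)) - 1))
      volume 0 x :=
    ((H.intervalIntegrable_potential.mul_continuousOn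
      (continuous_wave l).continuousOn).mul_continuousOn hcE).mono_set hsub
  have e : logRatio p q a α l x = -((∫ t in (0 : ℝ)..x, potential p q t * wave a α l t) +
      ∫ t in (0 : ℝ)..x, potential p q t * wave a α l t *
        (Complex.exp (Complex.I * ((-(2 * (logRatio p q a α l t).im) : ℝ) : ℂ)) - 1)) := by
    rw [H.logRatio_eq l hx, ← intervalIntegral.integral_add hi1 hi2]
    congr 1
    refine intervalIntegral.integral_congr fun t _ => ?_
    simp only [hsplit]
    ring
  have hle : ‖∫ t in (0 : ℝ)..x, potential p q t * wave a α l t *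
      (Complex.exp (Complex.I * ((-(2 * (logRatio p q a α l t).im) : ℝ) : ℂ)) - 1)‖ ≤
      ∫ t in (0 : ℝ)..x, 2 * ‖potential p q t‖ * ‖logRatio p q a α l t‖ := by
    refine intervalIntegral.norm_integral_le_of_norm_le hx.1 (Eventually.of_forall fun t _ => ?_)
      (((H.intervalIntegrable_potential.norm.const_mul 2).mul_continuousOn hΛc.norm).mono_set hsub)
    rw [norm_mul, norm_mul, norm_wave, mul_one]
    have h1 := Real.norm_exp_I_mul_ofReal_sub_one_le (x := -(2 * (logRatio p q a α l t).im))
    have h2 := Complex.abs_im_le_norm (logRatio p q a α l t)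
    rw [norm_neg, norm_mul, Real.norm_eq_abs, Real.norm_eq_abs, abs_two] at h1
    calc _ ≤ ‖potential p q t‖ * (2 * ‖logRatio p q a α l t‖) := by
          gcongr
          linarith
      _ = _ := by ring
  rw [e, norm_neg]
  exact (norm_add_le _ _).trans (add_le_add le_rfl hle)

/-- The complex phase corrections are square summable, uniformly in `x`. Bessel's inequality
controls the linear part of their integral equation, Grönwall's inequality the nonlinear part. -/
theorem exists_sum_sq_norm_logRatio_le (M : ℝ) :
    ∃ C : ℝ, 0 ≤ C ∧ ∀ l : Option ℤ → ℝ, (∀ i, |l i - lamZero a α i| ≤ M) →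
      ∀ x ∈ Icc 0 π, ∀ S : Finset (Option ℤ),
        ∑ i ∈ S, ‖logRatio p q a α (l i) x‖ ^ 2 ≤ C := by
  have hpi := Real.pi_pos.le
  obtain ⟨B, hB0, hB⟩ := H.exists_sum_option_sq_norm_integral_wave_le H.memLp_potential M
  set k : ℝ → ℝ := fun t => 2 * ‖potential p q t‖ with hk
  have hkL : MemLp k 2 (volume.restrict (Ioc 0 π)) := H.memLp_potential.norm.const_mul 2
  set K : ℝ := ∫ t in (0 : ℝ)..π, k t ^ 2
  have hK0 : 0 ≤ K := intervalIntegral.integral_nonneg hpi fun _ _ => sq_nonneg _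
  refine ⟨2 * B * Real.exp (2 * K * π), by positivity, fun l hl x hx S => ?_⟩
  have hc : ∀ i, ContinuousOn (fun x => ‖logRatio p q a α (l i) x‖) (Icc 0 π) := fun i => by
    simpa [uIcc_of_le hpi] using (H.isPrimitive_logRatio (l i)).continuousOn.norm
  have hc2 : ∀ i, ContinuousOn (fun x => ‖logRatio p q a α (l i) x‖ ^ 2) (Icc 0 π) :=
    fun i => (hc i).pow 2
  have hG := le_mul_exp_of_le_add_integral (b := π) (m := 2 * B) (c := 2 * K) (by positivity)
    (continuousOn_finsetSum S fun i _ => hc2 i) (fun y hy => ?_) x hx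
  · refine hG.trans ?_
    gcongr
    exact hx.2
  · have hterm : ∀ i, ‖logRatio p q a α (l i) y‖ ^ 2 ≤
        2 * ‖∫ t in (0 : ℝ)..y, potential p q t * wave a α (l i) t‖ ^ 2 +
          2 * K * ∫ t in (0 : ℝ)..y, ‖logRatio p q a α (l i) t‖ ^ 2 := by
      intro i
      have h1 := pow_le_pow_left₀ (norm_nonneg _) (H.norm_logRatio_le_add_integral (l i) hy) 2
      have h2 := sq_intervalIntegral_mul_le hkL hy (memLp_two_of_continuousOn (hc i) hy)
      refine h1.trans ?_
      nlinarith [sq_nonneg (‖∫ t in (0 : ℝ)..y, potential p q t * wave a α (l i) t‖ -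
        ∫ t in (0 : ℝ)..y, k t * ‖logRatio p q a α (l i) t‖)]
    refine (Finset.sum_le_sum fun i _ => hterm i).trans ?_
    rw [Finset.sum_add_distrib, ← Finset.mul_sum, ← Finset.mul_sum,
      intervalIntegral.integral_finsetSum fun i _ => ?_]
    · gcongr
      exact hB l hl y hy S
    · refine ContinuousOn.intervalIntegrable ?_
      rw [uIcc_of_le hy.1]
      exact (hc2 i).mono (Icc_subset_Icc_right hy.2)

end Admissible

end DiracBVP

/-! ### Numbering of the eigenvalues -/

namespace DiracBVP

open Filter Topology

theorem pi_div_two_sub_arctan_mul_le (x : ℝ) : (π / 2 - Real.arctan x) * x ≤ 1 := by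
  have h0 : 0 ≤ π / 2 - Real.arctan x := sub_nonneg.2 (Real.arctan_lt_pi_div_two x).le
  rcases le_or_gt x 0 with hx | hx
  · exact (mul_nonpos_of_nonneg_of_nonpos h0 hx).trans zero_le_one
  · rw [← Real.arctan_inv_of_pos hx]
    have h1 : 0 ≤ Real.arctan x⁻¹ := Real.arctan_nonneg.2 (by positivity)
    have h2 := Real.le_tan h1 (Real.arctan_lt_pi_div_two _)
    rw [Real.tan_arctan] at h2
    calc _ ≤ x⁻¹ * x := by gcongr
      _ = 1 := inv_mul_cancel₀ hx.ne'

theorem abs_exp_sub_one_le_mul {u R : ℝ} (h : |u| ≤ R) : |Real.exp u - 1| ≤ Real.exp R * |u| := by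
  have hR : 0 ≤ R := (abs_nonneg _).trans h
  have h1 : 1 ≤ Real.exp R := Real.one_le_exp hR
  rcases le_total 0 u with hu | hu
  · rw [abs_of_nonneg (sub_nonneg.2 (Real.one_le_exp hu)), abs_of_nonneg hu]
    rw [abs_of_nonneg hu] at h
    have h2 := Real.add_one_le_exp (-u)
    have h3 : Real.exp u * Real.exp (-u) = 1 := by rw [← Real.exp_add]; simp
    have h4 : Real.exp u ≤ Real.exp R := Real.exp_le_exp.2 h
    have h5 := mul_le_mul_of_nonneg_left h2 (Real.exp_pos u).le
    nlinarith [mul_le_mul_of_nonneg_right h4 hu]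
  · rw [abs_of_nonpos (sub_nonpos.2 (Real.exp_le_one_iff.2 hu)), abs_of_nonpos hu]
    have h2 := Real.add_one_le_exp u
    nlinarith

/-- The bijection between the index set `ℤ ∪ {*}` of the eigenvalues and the integers counting the
half-turns of the Prüfer phase: `arctan` turns by `π` between `-∞` and `∞`, so the count is shifted
by one on the negative side, which leaves `-1` for the additional index. -/
def turns : Option ℤ → ℤ
  | none => -1
  | some n => if 0 ≤ n then n else n - 1

theorem turns_bijective : Function.Bijective turns := by
  constructor
  · rintro (_ | m) (_ | n) h
    · rfl
    · simp only [turns] at h; split_ifs at h <;> omega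
    · simp only [turns] at h; split_ifs at h <;> omega
    · simp only [turns] at h
      split_ifs at h <;> exact congrArg some (by omega)
  · intro k
    rcases lt_trichotomy k (-1) with h | h | h
    · exact ⟨some (k + 1), by simp only [turns]; split_ifs <;> omega⟩
    · exact ⟨none, h.symm⟩
    · exact ⟨some k, by simp only [turns]; split_ifs <;> omega⟩

/-- The part of the correction to the eigenvalue with index `i` that comes from the boundary
condition at `π`. -/
noncomputable def boundaryShift (h₁ h₂ l : ℝ) : Option ℤ → ℝ
  | none => -(π / 2) - Real.arctan ((l + h₁) / h₂)
  | some n => (if 0 ≤ n then π / 2 else -(π / 2)) - Real.arctan ((l + h₁) / h₂)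

theorem abs_boundaryShift_le (h₁ h₂ l : ℝ) (i : Option ℤ) : |boundaryShift h₁ h₂ l i| ≤ π := by
  have h1 := Real.arctan_lt_pi_div_two ((l + h₁) / h₂)
  have h2 := Real.neg_pi_div_two_lt_arctan ((l + h₁) / h₂)
  rw [abs_le]
  rcases i with _ | n
  · simp only [boundaryShift]
    constructor <;> linarith
  · simp only [boundaryShift]
    split_ifs <;> constructor <;> linarith

/-- If `l` is at bounded distance from `n π / L`, then the boundary shift is `O(1 / n)`. -/
theorem abs_boundaryShift_mul_le {h₁ h₂ l M L : ℝ} (hh₂ : 0 < h₂) (hL : 0 < L) {n : ℤ}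
    (hl : |l - n * π / L| ≤ M) :
    |boundaryShift h₁ h₂ l (some n)| * |(n : ℝ)| ≤ L / π * (h₂ + π * (M + |h₁|)) := by
  have hπ := Real.pi_pos
  have hbd := abs_boundaryShift_le h₁ h₂ l (some n)
  set X := (l + h₁) / h₂ with hX
  have hXh : X * h₂ = l + h₁ := div_mul_cancel₀ _ hh₂.ne'
  obtain ⟨hl1, hl2⟩ := abs_le.1 hl
  obtain ⟨k1, k2⟩ := abs_le.1 (le_refl |h₁|)
  have hM : 0 ≤ M + |h₁| := add_nonneg ((abs_nonneg _).trans hl) (abs_nonneg _)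
  -- it suffices to bound the product with `|n| π / L`, which differs from `± (l + h₁)` boundedly
  have main : ∀ e s : ℝ, 0 ≤ e → e ≤ π → e * (s * X) ≤ 1 →
      s * (n * π / L) ≤ s * (l + h₁) + (M + |h₁|) →
      e * (s * n) ≤ L / π * (h₂ + π * (M + |h₁|)) := by
    intro e s he0 he he1 hs
    have h1 : e * (s * (l + h₁)) ≤ h₂ := by
      rw [← hXh]
      nlinarith
    have h2 : e * (s * (n * π / L)) ≤ h₂ + π * (M + |h₁|) := by
      refine (mul_le_mul_of_nonneg_left hs he0).trans ?_
      rw [mul_add]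
      exact add_le_add h1 (mul_le_mul_of_nonneg_right he hM)
    calc e * (s * n) = L / π * (e * (s * (n * π / L))) := by field_simp
      _ ≤ _ := by gcongr
  by_cases hn : 0 ≤ n
  · have hn' : (0 : ℝ) ≤ n := by exact_mod_cast hn
    have hpos : 0 ≤ π / 2 - Real.arctan X := sub_nonneg.2 (Real.arctan_lt_pi_div_two X).le
    simp only [boundaryShift, if_pos hn, ← hX] at hbd ⊢
    rw [abs_of_nonneg hpos] at hbd ⊢
    rw [abs_of_nonneg hn', ← one_mul (n : ℝ)]
    refine main _ 1 hpos hbd ?_ (by linarith)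
    rw [one_mul]
    exact pi_div_two_sub_arctan_mul_le X
  · have hn' : (n : ℝ) ≤ 0 := by exact_mod_cast (not_le.1 hn).le
    have hneg : -(π / 2) - Real.arctan X ≤ 0 := by
      linarith [Real.neg_pi_div_two_lt_arctan X]
    simp only [boundaryShift, if_neg hn, ← hX] at hbd ⊢
    rw [abs_of_nonpos hneg] at hbd ⊢
    rw [abs_of_nonpos hn', ← neg_one_mul (n : ℝ)]
    refine main _ (-1) (neg_nonneg.2 hneg) hbd ?_ (by linarith)
    have := pi_div_two_sub_arctan_mul_le (-X)
    rw [Real.arctan_neg] at this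
    linarith

theorem exists_sum_sq_boundaryShift_le {h₁ h₂ M L : ℝ} (hh₂ : 0 < h₂) (hL : 0 < L) :
    ∃ C : ℝ, 0 ≤ C ∧ ∀ l : Option ℤ → ℝ, (∀ n : ℤ, |l (some n) - n * π / L| ≤ M) →
      ∀ S : Finset (Option ℤ), ∑ i ∈ S, boundaryShift h₁ h₂ (l i) i ^ 2 ≤ C := by
  set K : ℝ := L / π * (h₂ + π * (M + |h₁|)) with hK
  have hsum : Summable fun n : ℤ => K ^ 2 * (1 / (n : ℝ) ^ 2) + if n = 0 then π ^ 2 else 0 :=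
    ((Real.summable_one_div_int_pow.2 one_lt_two).mul_left _).add
      (hasSum_ite_eq 0 (π ^ 2)).summable
  have hnn : ∀ n : ℤ, 0 ≤ K ^ 2 * (1 / (n : ℝ) ^ 2) + if n = 0 then π ^ 2 else 0 := fun n => by
    split_ifs <;> positivity
  refine ⟨π ^ 2 + ∑' n : ℤ, (K ^ 2 * (1 / (n : ℝ) ^ 2) + if n = 0 then π ^ 2 else 0),
    add_nonneg (sq_nonneg _) (tsum_nonneg hnn), fun l hl S => ?_⟩
  have hpi : ∀ i, boundaryShift h₁ h₂ (l i) i ^ 2 ≤ π ^ 2 := fun i =>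
    sq_le_sq.2 (by rw [abs_of_pos Real.pi_pos]; exact abs_boundaryShift_le _ _ _ _)
  refine sum_option_le (f := fun i => boundaryShift h₁ h₂ (l i) i ^ 2) (fun _ => sq_nonneg _)
    (hpi none) (fun T => ?_) S
  refine (Finset.sum_le_sum fun n _ => ?_).trans (hsum.sum_le_tsum T fun n _ => hnn n)
  by_cases hn : n = 0
  · subst hn
    simpa using hpi (some 0)
  · have hn' : 0 < |(n : ℝ)| := abs_pos.2 (by exact_mod_cast hn)
    have h := abs_boundaryShift_mul_le (h₁ := h₁) hh₂ hL (hl n)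
    rw [if_neg hn, add_zero, mul_one_div, ← sq_abs (n : ℝ), le_div_iff₀ (by positivity),
      ← sq_abs (boundaryShift _ _ _ _), ← mul_pow]
    exact pow_le_pow_left₀ (by positivity) h 2

namespace Admissible

variable {p q : ℝ → ℝ} {a α : ℝ} (H : Admissible p q a α)
include H

/-- The real zeros of `Δ`, numbered by `ℤ ∪ {*}`, with the equation that determines their
distance from the zeros of `z sin (z μ(π))`. -/
theorem exists_numbering {h₁ h₂ : ℝ} (hh₂ : 0 < h₂) :
    ∃ l : Option ℤ → ℝ, Function.Injective l ∧
      (∀ z : ℂ, charFun p q a α h₁ h₂ z = 0 ↔ ∃ i, (l i : ℂ) = z) ∧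
      ∀ i, (l i - lamZero a α i) * mu a α π =
        boundaryShift h₁ h₂ (l i) i - (logRatio p q a α (l i) π).im := by
  obtain ⟨ζ, hinj, hζ, hzero⟩ := H.exists_enumeration (h₁ := h₁) hh₂
  have hL := mu_pi_pos H.nonneg H.pos
  refine ⟨fun i => ζ (turns i), hinj.comp turns_bijective.1, fun z => ?_, fun i => ?_⟩
  · rw [hzero]
    exact turns_bijective.2.exists (p := fun k => (ζ k : ℂ) = z)
  · have h := hζ (turns i)
    rw [phase] at h
    rw [sub_mul]
    rcases i with _ | n
    · simp only [turns, lamZero, boundaryShift] at h ⊢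
      push_cast at h
      linarith
    · simp only [lamZero, boundaryShift]
      rw [div_mul_cancel₀ _ hL.ne']
      by_cases hn : 0 ≤ n
      · simp only [turns, if_pos hn] at h ⊢
        linarith
      · simp only [turns, if_neg hn] at h ⊢
        push_cast at h
        linarith

end Admissible

end DiracBVP

/-! ### Asymptotics of eigenvalues, eigenfunctions and normalizing numbers -/

namespace DiracBVP

open Filter Topology

theorem memℓp_two_of_sum_sq_le {ι F : Type*} [NormedAddCommGroup F] {f : ι → F} {C : ℝ}
    (h : ∀ S : Finset ι, ∑ i ∈ S, ‖f i‖ ^ 2 ≤ C) : Memℓp f 2 := by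
  refine memℓp_gen' (C := C) fun S => ?_
  simpa using h S

/-- The squared distance at `x` between `φ(·, l)` and the free solution with parameter `l₀`. -/
noncomputable def sqDeviation (p q : ℝ → ℝ) (a α l l₀ x : ℝ) : ℝ :=
  ‖(phi p q a α l x).1 - (Real.sin (l₀ * mu a α x) : ℂ)‖ ^ 2 +
    ‖(phi p q a α l x).2 + (Real.cos (l₀ * mu a α x) : ℂ)‖ ^ 2

namespace Admissible

variable {p q : ℝ → ℝ} {a α : ℝ} (H : Admissible p q a α)
include H

theorem norm_sq_phi_eq (l : ℝ) {x : ℝ} (hx : x ∈ Icc 0 π) :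
    ‖(phi p q a α l x).1‖ ^ 2 + ‖(phi p q a α l x).2‖ ^ 2 =
      Real.exp (2 * (logRatio p q a α l x).re) := by
  rw [H.phi_eq_phase l hx]
  simp only [Complex.norm_real, Real.norm_eq_abs, sq_abs]
  rw [two_mul, Real.exp_add]
  linear_combination (Real.exp (logRatio p q a α l x).re) ^ 2 *
    Real.sin_sq_add_cos_sq (phase p q a α l x)

/-- Prüfer's form of the solution bounds its deviation from the free solution. -/
theorem exists_sqDeviation_le : ∃ K : ℝ, 0 ≤ K ∧ ∀ l l₀ : ℝ, ∀ x ∈ Icc 0 π,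
    sqDeviation p q a α l l₀ x ≤ K * (‖logRatio p q a α l x‖ ^ 2 + |l - l₀| ^ 2) := by
  set R : ℝ := ∫ t in (0 : ℝ)..π, ‖potential p q t‖
  set L := mu a α π
  have hL : 0 < L := mu_pi_pos H.nonneg H.pos
  refine ⟨4 * ((Real.exp R + 1) ^ 2 + L ^ 2), by positivity, fun l l₀ x hx => ?_⟩
  set Λ := logRatio p q a α l x with hΛ
  set s := phase p q a α l x with hs
  have hre : |Λ.re| ≤ ‖Λ‖ := Complex.abs_re_le_norm _
  have him : |Λ.im| ≤ ‖Λ‖ := Complex.abs_im_le_norm _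
  have hexp : |Real.exp Λ.re - 1| ≤ Real.exp R * ‖Λ‖ :=
    (abs_exp_sub_one_le_mul (hre.trans (H.norm_logRatio_le l hx))).trans (by gcongr)
  have hmu : |mu a α x| ≤ L := by
    rw [abs_of_nonneg (mu_nonneg H.nonneg H.pos hx.1)]
    exact mu_mono H.pos hx.2
  have hphase : |s - l₀ * mu a α x| ≤ L * |l - l₀| + ‖Λ‖ := by
    have e : s - l₀ * mu a α x = (l - l₀) * mu a α x + Λ.im := by rw [hs, phase]; ring
    rw [e]
    refine (abs_add_le _ _).trans (add_le_add ?_ him)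
    rw [abs_mul, mul_comm]
    gcongr
  set T := (Real.exp R + 1) * ‖Λ‖ + L * |l - l₀| with hT
  -- both components have the form `exp Λ.re * c - c₀` with `c`, `c₀` values of `sin` or `cos`
  have hcomp : ∀ c c₀ : ℝ, |c| ≤ 1 → |c - c₀| ≤ |s - l₀ * mu a α x| →
      |Real.exp Λ.re * c - c₀| ^ 2 ≤ T ^ 2 := by
    intro c c₀ hc hcc
    refine pow_le_pow_left₀ (abs_nonneg _) ?_ 2
    rw [show Real.exp Λ.re * c - c₀ = (Real.exp Λ.re - 1) * c + (c - c₀) by ring]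
    refine (abs_add_le _ _).trans ?_
    rw [abs_mul]
    have h1 : |Real.exp Λ.re - 1| * |c| ≤ Real.exp R * ‖Λ‖ :=
      (mul_le_of_le_one_right (abs_nonneg _) hc).trans hexp
    have h2 := hcc.trans hphase
    rw [hT]
    linarith
  have h1 := hcomp _ _ (Real.abs_sin_le_one s) (Real.abs_sin_sub_sin_le s (l₀ * mu a α x))
  have h2 := hcomp _ _ (Real.abs_cos_le_one s) (Real.abs_cos_sub_cos_le s (l₀ * mu a α x))
  have e1 : ‖(phi p q a α l x).1 - (Real.sin (l₀ * mu a α x) : ℂ)‖ =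
      |Real.exp Λ.re * Real.sin s - Real.sin (l₀ * mu a α x)| := by
    rw [H.phi_eq_phase l hx]
    simp only
    rw [← Complex.ofReal_sub, Complex.norm_real, Real.norm_eq_abs]
  have e2 : ‖(phi p q a α l x).2 + (Real.cos (l₀ * mu a α x) : ℂ)‖ =
      |Real.exp Λ.re * Real.cos s - Real.cos (l₀ * mu a α x)| := by
    rw [H.phi_eq_phase l hx]
    simp only
    rw [← Complex.ofReal_add, Complex.norm_real, Real.norm_eq_abs, ← abs_neg]
    congr 1
    ring
  rw [sqDeviation, e1, e2]
  have hTsq : T ^ 2 ≤ 2 * ((Real.exp R + 1) ^ 2 * ‖Λ‖ ^ 2) + 2 * (L ^ 2 * |l - l₀| ^ 2) := by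
    rw [hT]
    nlinarith [sq_nonneg ((Real.exp R + 1) * ‖Λ‖ - L * |l - l₀|)]
  have h3 : 0 ≤ (Real.exp R + 1) ^ 2 * |l - l₀| ^ 2 := by positivity
  have h4 : 0 ≤ L ^ 2 * ‖Λ‖ ^ 2 := by positivity
  linarith

theorem integral_rho : ∫ t in (0 : ℝ)..π, rho a α t = mu a α π := by
  have h := (isPrimitive_mu (a := a) H.pos 0 π).eq_add_integral π right_mem_uIcc
  rw [mu_zero H.nonneg, Complex.ofReal_zero, zero_add, intervalIntegral.integral_ofReal] at h
  exact_mod_cast h.symm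

/-- The deviation of a normalizing number from `μ(π)`. -/
theorem exists_sq_normNumber_sub_le {h₂ : ℝ} (hh₂ : 0 < h₂) : ∃ K : ℝ, 0 ≤ K ∧
    ∀ l l₀ : ℝ, Real.sin (l₀ * mu a α π) = 0 →
      (normNumber p q a α h₂ l - mu a α π) ^ 2 ≤
        K * ((∫ t in (0 : ℝ)..π, ‖logRatio p q a α l t‖ ^ 2) + sqDeviation p q a α l l₀ π) := by
  have hpi := Real.pi_pos.le
  have hα := H.pos
  have hmem : π ∈ Icc 0 π := ⟨hpi, le_rfl⟩
  set R : ℝ := ∫ t in (0 : ℝ)..π, ‖potential p q t‖ with hR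
  set c : ℝ := (1 + α) * (2 * Real.exp (2 * R)) with hc
  refine ⟨2 * (c ^ 2 * π) + 2 * ((1 / h₂) ^ 2 * Real.exp (2 * R)), by positivity,
    fun l l₀ hl₀ => ?_⟩
  have hΛ := (H.isPrimitive_logRatio l).continuousOn
  have hΛ' : ContinuousOn (fun t => ‖logRatio p q a α l t‖) (Icc 0 π) := by
    simpa [uIcc_of_le hpi] using hΛ.norm
  have hexp : ∀ t ∈ Icc 0 π, |Real.exp (2 * (logRatio p q a α l t).re) - 1| ≤
      2 * Real.exp (2 * R) * ‖logRatio p q a α l t‖ := by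
    intro t ht
    have h1 := Complex.abs_re_le_norm (logRatio p q a α l t)
    have h2 := H.norm_logRatio_le l ht
    have h3 : |2 * (logRatio p q a α l t).re| ≤ 2 * ‖logRatio p q a α l t‖ := by
      rw [abs_mul, abs_two]
      linarith
    refine (abs_exp_sub_one_le_mul (h3.trans (by linarith : _ ≤ 2 * R))).trans ?_
    calc _ ≤ Real.exp (2 * R) * (2 * ‖logRatio p q a α l t‖) := by gcongr
      _ = _ := by ring
  have hρi := intervalIntegrable_rho (a := a) hα 0 π
  have hEi : IntervalIntegrable (fun t => Real.exp (2 * (logRatio p q a α l t).re) * rho a α t)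
      volume 0 π :=
    hρi.continuousOn_mul
      (Real.continuous_exp.comp_continuousOn
        (continuousOn_const.mul (Complex.continuous_re.comp_continuousOn hΛ)))
  have e : normNumber p q a α h₂ l - mu a α π =
      (∫ t in (0 : ℝ)..π, (Real.exp (2 * (logRatio p q a α l t).re) - 1) * rho a α t) +
        1 / h₂ * ‖(phi p q a α l π).1‖ ^ 2 := by
    have e1 : ∫ t in (0 : ℝ)..π,
        (‖(phi p q a α l t).1‖ ^ 2 + ‖(phi p q a α l t).2‖ ^ 2) * rho a α t =
        ∫ t in (0 : ℝ)..π, Real.exp (2 * (logRatio p q a α l t).re) * rho a α t := by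
      refine intervalIntegral.integral_congr fun t ht => ?_
      rw [uIcc_of_le hpi] at ht
      simp only [H.norm_sq_phi_eq l ht]
    simp only [sub_mul, one_mul]
    rw [normNumber, e1, intervalIntegral.integral_sub hEi hρi, H.integral_rho]
    ring
  have hI : |∫ t in (0 : ℝ)..π, (Real.exp (2 * (logRatio p q a α l t).re) - 1) * rho a α t| ≤
      c * ∫ t in (0 : ℝ)..π, ‖logRatio p q a α l t‖ := by
    rw [← intervalIntegral.integral_const_mul, ← Real.norm_eq_abs]
    refine intervalIntegral.norm_integral_le_of_norm_le hpi (Eventually.of_forall fun t ht => ?_)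
      (hΛ.norm.intervalIntegrable.const_mul _)
    rw [norm_mul, Real.norm_eq_abs, Real.norm_eq_abs, abs_of_pos (rho_pos hα t)]
    have h1 := hexp t (Ioc_subset_Icc_self ht)
    have h2 := rho_le (a := a) hα t
    have h3 := rho_pos (a := a) hα t
    calc _ ≤ (2 * Real.exp (2 * R) * ‖logRatio p q a α l t‖) * (1 + α) := by gcongr
      _ = _ := by rw [hc]; ring
  have hcs := sq_integral_le hmem hΛ'
  have hI2 : (∫ t in (0 : ℝ)..π, (Real.exp (2 * (logRatio p q a α l t).re) - 1) * rho a α t) ^ 2 ≤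
      c ^ 2 * (π * ∫ t in (0 : ℝ)..π, ‖logRatio p q a α l t‖ ^ 2) := by
    rw [← sq_abs]
    refine (pow_le_pow_left₀ (abs_nonneg _) hI 2).trans ?_
    rw [mul_pow]
    gcongr
  have hφ1 : ‖(phi p q a α l π).1‖ ^ 2 ≤ Real.exp (2 * R) := by
    have h1 := H.norm_sq_phi_eq l hmem
    have h2 := (Complex.re_le_norm (logRatio p q a α l π)).trans (H.norm_logRatio_le l hmem)
    have h3 : Real.exp (2 * (logRatio p q a α l π).re) ≤ Real.exp (2 * R) := by gcongr
    linarith [sq_nonneg ‖(phi p q a α l π).2‖]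
  have hdev : ‖(phi p q a α l π).1‖ ^ 2 ≤ sqDeviation p q a α l l₀ π := by
    rw [sqDeviation, hl₀, Complex.ofReal_zero, sub_zero]
    linarith [sq_nonneg ‖(phi p q a α l π).2 + (Real.cos (l₀ * mu a α π) : ℂ)‖]
  have hb : (1 / h₂ * ‖(phi p q a α l π).1‖ ^ 2) ^ 2 ≤
      (1 / h₂) ^ 2 * (Real.exp (2 * R) * sqDeviation p q a α l l₀ π) := by
    rw [mul_pow, sq (‖_‖ ^ 2)]
    gcongr
  have hJ : 0 ≤ ∫ t in (0 : ℝ)..π, ‖logRatio p q a α l t‖ ^ 2 :=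
    intervalIntegral.integral_nonneg hpi fun _ _ => sq_nonneg _
  have hdev0 : 0 ≤ sqDeviation p q a α l l₀ π := (sq_nonneg _).trans hdev
  rw [e]
  refine (add_sq_le).trans ?_
  have x1 : 0 ≤ c ^ 2 * π * sqDeviation p q a α l l₀ π := by positivity
  have x2 : 0 ≤ (1 / h₂) ^ 2 * Real.exp (2 * R) *
    ∫ t in (0 : ℝ)..π, ‖logRatio p q a α l t‖ ^ 2 := by positivity
  linarith

end Admissible

theorem sin_lamZero_mul_mu_pi {a α : ℝ} (hL : 0 < mu a α π) (i : Option ℤ) :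
    Real.sin (lamZero a α i * mu a α π) = 0 := by
  rcases i with _ | n
  · simp [lamZero]
  · rw [lamZero, div_mul_cancel₀ _ hL.ne']
    exact Real.sin_int_mul_pi n

theorem analyticOrderAt_mul_sin {a α : ℝ} (hL : 0 < mu a α π) (z : ℂ) :
    analyticOrderAt (fun w : ℂ => w * Complex.sin (w * (mu a α π : ℂ))) z =
      Set.encard {i : Option ℤ | (lamZero a α i : ℂ) = z} := by
  have hLc : (mu a α π : ℂ) ≠ 0 := by exact_mod_cast hL.ne'
  have hder : ∀ w : ℂ, HasDerivAt (fun w : ℂ => Complex.sin (w * (mu a α π : ℂ)))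
      (Complex.cos (w * mu a α π) * mu a α π) w := fun w => by
    simpa using ((hasDerivAt_id w).mul_const (mu a α π : ℂ)).csin
  have hsin : AnalyticAt ℂ (fun w : ℂ => Complex.sin (w * (mu a α π : ℂ))) z :=
    Differentiable.analyticAt (fun w => (hder w).differentiableAt) z
  have hzero : ∀ n : ℤ, (lamZero a α (some n) : ℂ) = z ↔ z * mu a α π = n * π := by
    intro n
    simp only [lamZero]
    push_cast
    rw [div_eq_iff hLc, eq_comm]
  have hord : analyticOrderAt (fun w : ℂ => w * Complex.sin (w * (mu a α π : ℂ))) z =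
      analyticOrderAt (fun w : ℂ => w) z +
        analyticOrderAt (fun w : ℂ => Complex.sin (w * (mu a α π : ℂ))) z :=
    analyticOrderAt_mul analyticAt_id hsin
  have hone : Complex.sin (z * mu a α π) = 0 →
      analyticOrderAt (fun w : ℂ => Complex.sin (w * (mu a α π : ℂ))) z = 1 := by
    intro hs
    refine hsin.analyticOrderAt_eq_one_of_zero_deriv_ne_zero hs ?_
    rw [(hder z).deriv]
    refine mul_ne_zero (fun hc => ?_) hLc
    have := Complex.sin_sq_add_cos_sq (z * mu a α π)
    rw [hs, hc] at this
    simp at this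
  rw [hord]
  by_cases hz : z = 0
  · subst hz
    have hset : {i : Option ℤ | (lamZero a α i : ℂ) = 0} = {none, some 0} := by
      ext i
      rcases i with _ | n
      · simp [lamZero]
      · simp only [mem_ofPred_eq, hzero]
        simp [Real.pi_pos.ne', eq_comm]
    have hid : analyticOrderAt (fun w : ℂ => w) 0 = 1 :=
      analyticAt_id.analyticOrderAt_eq_one_of_zero_deriv_ne_zero rfl (by simp)
    rw [hset, Set.encard_pair (by simp), hid, hone (by simp)]
    rfl
  · have hid : analyticOrderAt (fun w : ℂ => w) z = 0 :=
      analyticAt_id.analyticOrderAt_eq_zero.2 hz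
    rw [hid, zero_add]
    by_cases hs : Complex.sin (z * mu a α π) = 0
    · obtain ⟨k, hk⟩ := Complex.sin_eq_zero_iff.1 hs
      have hset : {i : Option ℤ | (lamZero a α i : ℂ) = z} = {some k} := by
        ext i
        rcases i with _ | n
        · simp [lamZero, Ne.symm hz]
        · simp only [mem_ofPred_eq, hzero, hk, mem_singleton_iff, Option.some_inj]
          have hpi : (π : ℂ) ≠ 0 := by exact_mod_cast Real.pi_pos.ne'
          rw [mul_left_inj' hpi, Int.cast_inj, eq_comm]
      rw [hset, Set.encard_singleton, hone hs]
    · have hset : {i : Option ℤ | (lamZero a α i : ℂ) = z} = ∅ := by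
        ext i
        rcases i with _ | n
        · simp [lamZero, Ne.symm hz]
        · simp only [mem_ofPred_eq, hzero, mem_empty_iff_false, iff_false]
          intro hn
          exact hs (Complex.sin_eq_zero_iff.2 ⟨n, hn⟩)
      rw [hset, Set.encard_empty]
      exact hsin.analyticOrderAt_eq_zero.2 hs

end DiracBVP

/-! ### Uniform square sums and the eigenvalue list -/

namespace DiracBVP

open Filter Topology

namespace Admissible

variable {p q : ℝ → ℝ} {a α : ℝ} (H : Admissible p q a α)
include H

/-- The square sums of all corrections, for the numbering of the eigenvalues by `ℤ ∪ {*}`. -/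
theorem exists_sum_bounds {h₁ h₂ : ℝ} (hh₂ : 0 < h₂) {l : Option ℤ → ℝ}
    (hl : ∀ i, (l i - lamZero a α i) * mu a α π =
      boundaryShift h₁ h₂ (l i) i - (logRatio p q a α (l i) π).im) :
    ∃ C : ℝ, 0 < C ∧ ∀ S : Finset (Option ℤ),
      ∑ i ∈ S, |l i - lamZero a α i| ^ 2 ≤ C ∧
      (∀ x ∈ Icc 0 π, ∑ i ∈ S, sqDeviation p q a α (l i) (lamZero a α i) x ≤ C) ∧
      ∑ i ∈ S, (normNumber p q a α h₂ (l i) - mu a α π) ^ 2 ≤ C := by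
  have hpi := Real.pi_pos.le
  have hmem : π ∈ Icc 0 π := ⟨hpi, le_rfl⟩
  have hL := mu_pi_pos H.nonneg H.pos
  set L := mu a α π with hLdef
  set R : ℝ := ∫ t in (0 : ℝ)..π, ‖potential p q t‖
  set M : ℝ := (π + R) / L
  have hclose : ∀ i, |l i - lamZero a α i| ≤ M := by
    intro i
    rw [le_div_iff₀ hL, ← abs_of_pos hL, ← abs_mul, hl i]
    exact (abs_sub _ _).trans (add_le_add (abs_boundaryShift_le _ _ _ _)
      ((Complex.abs_im_le_norm _).trans (H.norm_logRatio_le _ hmem)))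
  obtain ⟨C₁, hC₁, h1⟩ := H.exists_sum_sq_norm_logRatio_le M
  obtain ⟨C₂, hC₂, h2⟩ := exists_sum_sq_boundaryShift_le (h₁ := h₁) (M := M) hh₂ hL
  obtain ⟨K₁, hK₁, h3⟩ := H.exists_sqDeviation_le
  obtain ⟨K₂, hK₂, h4⟩ := H.exists_sq_normNumber_sub_le hh₂
  have h1 := h1 l hclose
  have h2 := h2 l fun n => hclose (some n)
  set D₁ := 2 / L ^ 2 * (C₂ + C₁) with hD₁
  set D₂ := K₁ * (C₁ + D₁) with hD₂
  set D₃ := K₂ * (π * C₁ + D₂) with hD₃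
  have hD₁0 : 0 ≤ D₁ := by positivity
  have hD₂0 : 0 ≤ D₂ := by positivity
  have hD₃0 : 0 ≤ D₃ := by positivity
  have b1 : ∀ S : Finset (Option ℤ), ∑ i ∈ S, |l i - lamZero a α i| ^ 2 ≤ D₁ := by
    intro S
    have hterm : ∀ i, |l i - lamZero a α i| ^ 2 ≤ 2 / L ^ 2 *
        (boundaryShift h₁ h₂ (l i) i ^ 2 + ‖logRatio p q a α (l i) π‖ ^ 2) := by
      intro i
      have him := pow_le_pow_left₀ (abs_nonneg _)
        (Complex.abs_im_le_norm (logRatio p q a α (l i) π)) 2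
      rw [sq_abs] at him
      rw [sq_abs, div_mul_eq_mul_div, le_div_iff₀ (by positivity), ← mul_pow, hl i]
      nlinarith [sq_nonneg (boundaryShift h₁ h₂ (l i) i + (logRatio p q a α (l i) π).im)]
    refine (Finset.sum_le_sum fun i _ => hterm i).trans ?_
    rw [← Finset.mul_sum, Finset.sum_add_distrib, hD₁]
    have := h1 π hmem S
    have := h2 S
    gcongr
  have b2 : ∀ S : Finset (Option ℤ), ∀ x ∈ Icc 0 π,
      ∑ i ∈ S, sqDeviation p q a α (l i) (lamZero a α i) x ≤ D₂ := by
    intro S x hx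
    refine (Finset.sum_le_sum fun i _ => h3 (l i) (lamZero a α i) x hx).trans ?_
    rw [← Finset.mul_sum, Finset.sum_add_distrib, hD₂]
    have := h1 x hx S
    have := b1 S
    gcongr
  have b3 : ∀ S : Finset (Option ℤ),
      ∑ i ∈ S, (normNumber p q a α h₂ (l i) - L) ^ 2 ≤ D₃ := by
    intro S
    refine (Finset.sum_le_sum fun i _ =>
      h4 (l i) (lamZero a α i) (sin_lamZero_mul_mu_pi hL i)).trans ?_
    have hc : ∀ i, ContinuousOn (fun x => ‖logRatio p q a α (l i) x‖ ^ 2) (uIcc 0 π) := fun i =>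
      (H.isPrimitive_logRatio (l i)).continuousOn.norm.pow 2
    rw [← Finset.mul_sum, Finset.sum_add_distrib, hD₃,
      ← intervalIntegral.integral_finsetSum fun i _ => (hc i).intervalIntegrable]
    have hint := intervalIntegral.integral_mono_on hpi
      ((continuousOn_finsetSum S fun i _ => hc i).intervalIntegrable)
      (intervalIntegrable_const (μ := volume) (c := C₁)) (fun t ht => h1 t ht S)
    rw [intervalIntegral.integral_const, sub_zero, smul_eq_mul] at hint
    have := b2 S π hmem
    gcongr
  refine ⟨D₁ + D₂ + D₃ + 1, by positivity, fun S => ⟨?_, fun x hx => ?_, ?_⟩⟩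
  · linarith [b1 S]
  · linarith [b2 S x hx]
  · linarith [b3 S]

end Admissible

end DiracBVP

theorem theorem1 (p q : ℝ → ℝ) (a α h₁ h₂ : ℝ)
    (hp : MemLp p 2 (volume.restrict (Set.Ioo (0 : ℝ) π)))
    (hq : MemLp q 2 (volume.restrict (Set.Ioo (0 : ℝ) π)))
    (ha₀ : 0 ≤ a) (haπ : a ≤ π) (hα : 0 < α) (hα₁ : α ≠ 1) (hh₂ : 0 < h₂) :
    -- `φ(·, z)` is, for every complex `z`, the unique solution with initial value `(0, -1)`
    (∀ z : ℂ, DiracBVP.IsSolution p q a α z (DiracBVP.phi p q a α z) ∧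
      DiracBVP.phi p q a α z 0 = (0, -1) ∧
      ∀ y : ℝ → ℂ × ℂ, DiracBVP.IsSolution p q a α z y → y 0 = (0, -1) →
        ∀ x ∈ Set.Icc (0 : ℝ) π, y x = DiracBVP.phi p q a α z x) ∧
    -- the unperturbed numbers list the zeros of `z sin (z μ(π))` with multiplicity
    (∀ z : ℂ, analyticOrderAt
        (fun w : ℂ => w * Complex.sin (w * (DiracBVP.mu a α π : ℂ))) z =
      Set.encard {i : Option ℤ | (DiracBVP.lamZero a α i : ℂ) = z}) ∧
    ∃ lam : Option ℤ → ℂ,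
      -- `lam` lists the eigenvalues, each as often as its order as a zero of `Δ`
      ({z : ℂ | DiracBVP.IsEigenvalue p q a α h₁ h₂ z} = Set.range lam) ∧
      (∀ z : ℂ, analyticOrderAt (DiracBVP.charFun p q a α h₁ h₂) z =
        Set.encard {i : Option ℤ | lam i = z}) ∧
      -- (i)
      Memℓp (fun i : Option ℤ => lam i - (DiracBVP.lamZero a α i : ℂ)) 2 ∧
      (∃ N : ℕ, ∀ n : ℤ, (N : ℤ) ≤ |n| →
        analyticOrderAt (DiracBVP.charFun p q a α h₁ h₂) (lam (some n)) = 1) ∧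
      -- (ii)
      (∀ i : Option ℤ,
        DiracBVP.IsEigenfunction p q a α h₁ h₂ (lam i) (DiracBVP.phi p q a α (lam i)) ∧
        ∀ y : ℝ → ℂ × ℂ, DiracBVP.IsEigenfunction p q a α h₁ h₂ (lam i) y →
          ∃ c : ℂ, ∀ x ∈ Set.Icc (0 : ℝ) π, y x = c • DiracBVP.phi p q a α (lam i) x) ∧
      (∃ C : ℝ, 0 < C ∧ ∀ x ∈ Set.Icc (0 : ℝ) π,
        Summable (fun i : Option ℤ =>
          ‖(DiracBVP.phi p q a α (lam i) x).1
              - (Real.sin (DiracBVP.lamZero a α i * DiracBVP.mu a α x) : ℂ)‖ ^ 2 +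
          ‖(DiracBVP.phi p q a α (lam i) x).2
              + (Real.cos (DiracBVP.lamZero a α i * DiracBVP.mu a α x) : ℂ)‖ ^ 2) ∧
        ∑' i : Option ℤ,
          (‖(DiracBVP.phi p q a α (lam i) x).1
              - (Real.sin (DiracBVP.lamZero a α i * DiracBVP.mu a α x) : ℂ)‖ ^ 2 +
          ‖(DiracBVP.phi p q a α (lam i) x).2
              + (Real.cos (DiracBVP.lamZero a α i * DiracBVP.mu a α x) : ℂ)‖ ^ 2) ≤ C) ∧
      -- (iii)
      Memℓp (fun i : Option ℤ =>
        DiracBVP.normNumber p q a α h₂ (lam i) - DiracBVP.mu a α π) 2 := by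
  have hIoc : ∀ {r : ℝ → ℝ}, MemLp r 2 (volume.restrict (Set.Ioo (0 : ℝ) π)) →
      MemLp r 2 (volume.restrict (Set.Ioc (0 : ℝ) π)) := fun hr => by
    rwa [← Measure.restrict_congr_set Ioo_ae_eq_Ioc]
  have H : DiracBVP.Admissible p q a α := ⟨hIoc hp, hIoc hq, ha₀, haπ, hα⟩
  have hL := DiracBVP.mu_pi_pos H.nonneg H.pos
  obtain ⟨l, hinj, hzero, hshift⟩ := H.exists_numbering (h₁ := h₁) hh₂
  obtain ⟨C, hC, hsum⟩ := H.exists_sum_bounds hh₂ hshift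
  have hroot : ∀ i, DiracBVP.charFun p q a α h₁ h₂ (l i) = 0 := fun i => (hzero _).2 ⟨i, rfl⟩
  refine ⟨fun z => ⟨(H.phi_spec z).1, (H.phi_spec z).2, fun y hy h0 =>
    H.eqOn_of_isSolution hy (H.phi_spec z).1 (h0.trans (H.phi_spec z).2.symm)⟩,
    DiracBVP.analyticOrderAt_mul_sin hL, fun i => (l i : ℂ), ?_, fun z => ?_, ?_, ⟨0, fun n _ =>
      H.analyticOrderAt_charFun_eq_one hh₂ (hroot _)⟩, fun i =>
      ⟨H.isEigenfunction_phi (hroot i), fun y hy =>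
        ⟨_, H.eq_smul_phi hy.solution hy.left⟩⟩, ⟨C, hC, fun x hx => ?_⟩, ?_⟩
  · ext z
    exact H.isEigenvalue_iff.trans (hzero z)
  · by_cases hz : DiracBVP.charFun p q a α h₁ h₂ z = 0
    · obtain ⟨j, rfl⟩ := (hzero z).1 hz
      have hset : {i | (l i : ℂ) = l j} = {j} := by
        ext i
        simp [hinj.eq_iff]
      rw [H.analyticOrderAt_charFun_eq_one hh₂ hz, hset, Set.encard_singleton]
    · have hset : {i | (l i : ℂ) = z} = ∅ :=
        Set.eq_empty_of_forall_notMem fun i hi => hz ((hzero z).2 ⟨i, hi⟩)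
      rw [((H.differentiable_charFun h₁ h₂).analyticAt z).analyticOrderAt_eq_zero.2 hz, hset,
        Set.encard_empty]
  · refine DiracBVP.memℓp_two_of_sum_sq_le (C := C) fun S => ?_
    simpa only [← Complex.ofReal_sub, Complex.norm_real, Real.norm_eq_abs] using (hsum S).1
  · have hnn : ∀ i, 0 ≤ DiracBVP.sqDeviation p q a α (l i) (DiracBVP.lamZero a α i) x :=
      fun i => add_nonneg (sq_nonneg _) (sq_nonneg _)
    have hS : ∀ S : Finset (Option ℤ),
        ∑ i ∈ S, DiracBVP.sqDeviation p q a α (l i) (DiracBVP.lamZero a α i) x ≤ C :=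
      fun S => (hsum S).2.1 x hx
    exact ⟨summable_of_sum_le hnn hS, Real.tsum_le_of_sum_le hnn hS⟩
  · refine DiracBVP.memℓp_two_of_sum_sq_le (C := C) fun S => ?_
    simpa only [Real.norm_eq_abs, sq_abs] using (hsum S).2.2
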